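/- Let $B$ be a smooth manifold and $LB$ its free loop space (smooth maps $S^1=\mathbb R/\mathbb Z\to B$). A gerbe with connection $\mathcal G$ on $B$ consists of an open covering $(U_\alpha)_{\alpha\in I}$ of $B$; Hermitian line bundles with Hermitian connection $L_{\alpha\beta}$ on $U_\alpha\cap U_\beta$ with unitary, mutually dual, connection-preserving isomorphisms $L_{\beta\alpha}\cong L_{\alpha\beta}^*$; parallel sections $\theta_{\alpha\beta\gamma}$ of unit length of $L_{\alpha\beta}\otimes L_{\beta\gamma}\otimes L_{\gamma\alpha}$ on $U_\alpha\cap U_\beta\cap U_\gamma$, alternating in the indices (invariant under cyclic permutations, inverted by odd permutations; in particular $L_{\alpha\alpha}$ is canonically trivial), with $\theta_{\beta\gamma\delta}\theta_{\alpha\gamma\delta}^{-1}\theta_{\alpha\beta\delta}\theta_{\alpha\beta\gamma}^{-1}=1$; and real $2$-forms $F_\alpha\in\Omega^2(U_\alpha)$ with $F_\beta-F_\alpha=c_1(\nabla^{L_{\alpha\beta}}):=-\frac{1}{2\pi i}R^{\nabla^{L_{\alpha\beta}}}$ on $U_\alpha\cap U_\beta$. Its curvature $R^{\mathcal G}\in\Omega^3(B)$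 is the form with $R^{\mathcal G}|_{U_\alpha}=dF_\alpha$. The transgression $T(\mathcal G)$ is the following Hermitian line bundle with connection on $LB$. For $n\ge 1$, a monotone map $t:\mathbb Z/n\to S^1$ (running once around the circle) and a map $s:\mathbb Z/n\to I$ let $V(t,s)\subset LB$ be the set of loops $\gamma$ with $\gamma([t(i),t(i+1)])\subset U_{s(i-1)}\cap U_{s(i)}$ for all $i$. On $V(t,s)$ the fibre of $T(\mathcal G)$ at $\gamma$ is $\bigotimes_{i\in\mathbb Z/n}L_{s(i-1)s(i)}(\gamma(t(i)))$. Over intersections these bundles are identified as follows. For fixed $t$, the maps $\theta$ identify the fibre for $s$ with the fibre for $s'$ tensored with $\bigotimes_i \mathrm{Hom}\big(L_{s(i)s'(i)}(\gamma(t(i))),L_{s(i)s'(i)}(\gamma(t(i+1)))\big)$, and the last factor is trivialized by the parallel transports of $L_{s(i)s'(i)}$ along $\gamma|_{[t(i),t(i+1)]}$. Under a refinement of $(t,s)$ one uses the triviality of the bundles $L_{\alpha\alpha}$. The parallel transport of $T(\mathcal G)$ along a smooth path $\Gamma:[a,b]\to V(t,s)$ is $$\|^{T(\mathcal G)}_\Gamma=\bigotimes_{i}\|^{L_{s(i-1)s(i)}}_{\Gamma(\cdot)(t(i))}\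 \prod_{i}\exp\Big(2\pi i\int_a^b\int_{t(i)}^{t(i+1)}F_{s(i)}(\partial_t\Gamma,\partial_x\Gamma)\,dt\,dx\Big).$$ **Lemma.** The sets $V(t,s)$ cover $LB$, and the curvature of $T(\mathcal G)$ (on each $V(t,s)$, the $2$-form $R$ with $\nabla_x\nabla_yv-\nabla_y\nabla_xv=R(\partial_x\sigma,\partial_y\sigma)\,v$ for all smooth $2$-parameter families $\sigma(x,y)$ of loops in $V(t,s)$ and all smooth sections $v$ of $T(\mathcal G)$ along $\sigma$, where $\nabla$ is the covariant derivative belonging to the above parallel transport) is $$R^{T(\mathcal G)}=2\pi i\,T(R^{\mathcal G}),\qquad T(R^{\mathcal G})=\int_{S^1}i_{\partial_t}\,ev^*R^{\mathcal G}\,dt,$$ that is, $R^{T(\mathcal G)}_\gamma(X,Y)=2\pi i\int_0^1R^{\mathcal G}(\dot\gamma(t),X(t),Y(t))\,dt$ for $\gamma\in LB$ and tangent vectors $X,Y$ (vector fields along $\gamma$). -/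

import Mathlib

open Set Filter Topology
open scoped Manifold ContDiff TensorProduct

noncomputable section

namespace GerbeTransgression

universe uE uB uF uK uI

section Forms

variable (E : Type*) [NormedAddCommGroup E] [NormedSpace ℝ E]
variable {B : Type*} [TopologicalSpace B] [ChartedSpace E B]

/-- The tangent space of `B` at `x`, for `B` a manifold modelled on `E`. -/
abbrev Tan (x : B) : Type _ := TangentSpace 𝓘(ℝ, E) x

variable (B) in
/-- (Not necessarily smooth) differential forms of degree `k` on `B` with values in `F`. -/
abbrev Form (F : Type*) [NormedAddCommGroup F] [NormedSpace ℝ F] (k : ℕ) : Type _ :=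
  ∀ x : B, Tan E x [⋀^Fin k]→L[ℝ] F

variable {E} {F : Type*} [NormedAddCommGroup F] [NormedSpace ℝ F] {k : ℕ}

/-- The representation of a form in the chart around `x₀`, i.e. its pull-back under the inverse
of the chart. It is meaningful on the target of the chart. -/
def Form.inChart (η : Form E B F k) (x₀ : B) (y : E) : E [⋀^Fin k]→L[ℝ] F :=
  (η ((chartAt E x₀).symm y)).compContinuousLinearMap
    (mfderiv 𝓘(ℝ, E) 𝓘(ℝ, E) (chartAt E x₀).symm y : E →L[ℝ] Tan E ((chartAt E x₀).symm y))

/-- The form `η` is smooth on the open set `U`. -/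
def Form.SmoothOn (η : Form E B F k) (U : Set B) : Prop :=
  ∀ x₀ : B, ContDiffOn ℝ ∞ (Form.inChart η x₀)
    ((chartAt E x₀).target ∩ (chartAt E x₀).symm ⁻¹' U)

/-- The exterior derivative, computed at `x` in the chart around `x`:
`(dη)(v₀, …, vₖ) = ∑ⱼ (-1)ʲ D_{vⱼ} η(v₀, …, v̂ⱼ, …, vₖ)` for constant `vⱼ` in a chart. -/
def Form.d (η : Form E B F k) : Form E B F (k + 1) := fun x =>
  (extDeriv (Form.inChart η x) (chartAt E x x)).compContinuousLinearMap
    (mfderiv 𝓘(ℝ, E) 𝓘(ℝ, E) (chartAt E x) x : Tan E x →L[ℝ] E)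

variable (E) in
/-- `df = f · a` at the point `x`, for a complex valued function `f` and a complex valued
1-form `a`; i.e. `a = d log f` at `x` if `f x ≠ 0`. -/
def HasDLog (f : B → ℂ) (x : B) (a : Tan E x → ℂ) : Prop :=
  ∀ v : Tan E x, (mfderiv 𝓘(ℝ, E) 𝓘(ℝ, ℂ) f x v : ℂ) = f x * a v

variable (E) in
/-- The velocity vector of a path in `B`. -/
def velocity (c : ℝ → B) (τ : ℝ) : Tan E (c τ) :=
  mfderiv 𝓘(ℝ, ℝ) 𝓘(ℝ, E) c τ (1 : ℝ)

end Forms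

section LineBundles

variable (E : Type uE) [NormedAddCommGroup E] [NormedSpace ℝ E]
variable {B : Type uB} [TopologicalSpace B] [ChartedSpace E B]

/-- A smooth Hermitian line bundle with Hermitian connection over an open subset `U` of `B`.

* The fibres are one-dimensional complex inner product spaces. (Fibres are attached to all points
  of `B`; those over points outside `U` play no role.)
* The smooth structure is given by an atlas of local sections `frame i` of unit length over open
  sets `dom i` covering `U`, with smooth transition functions `frame i / frame j`.
* The connection is given by its local connection forms `A i = ∇ log (frame i)`, that is
  `∇ (frame i) = A i ⊗ frame i`. They are smooth and imaginary valued (the connection is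
  Hermitian), and they satisfy `A i - A j = d log (frame i / frame j)`. -/
structure HermLineBundle (U : Set B) where
  Fibre : B → Type uF
  [normedAddCommGroup : ∀ x, NormedAddCommGroup (Fibre x)]
  [innerProductSpace : ∀ x, InnerProductSpace ℂ (Fibre x)]
  finrank_fibre : ∀ x, Module.finrank ℂ (Fibre x) = 1
  FrameIdx : Type uK
  dom : FrameIdx → Set B
  isOpen_dom : ∀ i, IsOpen (dom i)
  dom_subset : ∀ i, dom i ⊆ U
  exists_mem_dom : ∀ x ∈ U, ∃ i, x ∈ dom i
  frame : FrameIdx → ∀ x, Fibre x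
  norm_frame : ∀ i, ∀ x ∈ dom i, ‖frame i x‖ = 1
  smooth_transition : ∀ i j,
    ContMDiffOn 𝓘(ℝ, E) 𝓘(ℝ, ℂ) ∞ (fun x => inner ℂ (frame j x) (frame i x)) (dom i ∩ dom j)
  A : FrameIdx → Form E B ℂ 1
  smooth_A : ∀ i, (A i).SmoothOn (dom i)
  imaginary_A : ∀ i, ∀ x ∈ dom i, ∀ v : Tan E x, (A i x ![v]).re = 0
  A_sub_A : ∀ i j, ∀ x ∈ dom i ∩ dom j,
    HasDLog E (fun x => inner ℂ (frame j x) (frame i x)) x (fun v => A i x ![v] - A j x ![v])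

attribute [instance] HermLineBundle.normedAddCommGroup HermLineBundle.innerProductSpace

namespace HermLineBundle

variable {E} {U : Set B} (L : HermLineBundle E U)

/-- The curvature `R^∇ = dA` on the domain of the frame number `i`. -/
def curvature (i : L.FrameIdx) : Form E B ℂ 2 := (L.A i).d

/-- The first Chern form `c₁(∇) = -1/(2πi) R^∇` on the domain of the frame number `i`. -/
def chernForm (i : L.FrameIdx) : Form E B ℂ 2 := fun x =>
  (-1 / (2 * Real.pi * Complex.I) : ℂ) • L.curvature i x

/-- The section `v` of `L` along the path `c` is parallel on the set `S` of times: whenever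
`v = f • frame i` near `τ`, then `f' = - A i (ċ) f` at `τ`. -/
def IsParallel (c : ℝ → B) (S : Set ℝ) (v : ∀ τ, L.Fibre (c τ)) : Prop :=
  ∀ τ ∈ S, ∀ i, c τ ∈ L.dom i →
    HasDerivWithinAt (fun τ' => inner ℂ (L.frame i (c τ')) (v τ'))
      (-(L.A i (c τ) ![velocity E c τ]) * inner ℂ (L.frame i (c τ)) (v τ)) S τ

/-- Parallel transport `L_{c(a)} → L_{c(b)}` along a smooth path `c` which stays in `U` between
the times `a` and `b`: the unique linear map which sends `v a` to `v b` for every parallel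
section `v` along `c`. -/
def transport (c : ℝ → B) (a b : ℝ) : L.Fibre (c a) →ₗ[ℂ] L.Fibre (c b) :=
  Classical.epsilon fun P => ∀ v : ∀ τ, L.Fibre (c τ), L.IsParallel c (uIcc a b) v → P (v a) = v b

end HermLineBundle

end LineBundles

section Gerbes

variable (E : Type uE) [NormedAddCommGroup E] [NormedSpace ℝ E]
variable (B : Type uB) [TopologicalSpace B] [ChartedSpace E B]

/-- A gerbe with connection on `B`, defined with respect to an open covering `(U α)`.

As usual for Čech data, `θ` is alternating, where the isomorphisms `L β α ≅ (L α β)*` are used to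
compare the lines: it is invariant under cyclic permutations of its indices, and it is
inverted by odd permutations. In particular the bundles `L α α` are canonically trivial. -/
structure GerbeWithConnection where
  /-- the covering -/
  Idx : Type uI
  U : Idx → Set B
  isOpen_U : ∀ α, IsOpen (U α)
  exists_mem_U : ∀ x, ∃ α, x ∈ U α
  /-- the Hermitian line bundles with connection on the double intersections -/
  L : ∀ α β, HermLineBundle.{uE, uB, uF, uK} E (U α ∩ U β)
  /-- the isomorphism `L β α ≅ (L α β)*`, written as a pairing: it is unitary, symmetric in the
  two indices, smooth and compatible with the connections -/
  pairing : ∀ α β x, (L α β).Fibre x →ₗ[ℂ] (L β α).Fibre x →ₗ[ℂ] ℂ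
  norm_pairing : ∀ α β, ∀ x ∈ U α ∩ U β, ∀ u w, ‖pairing α β x u w‖ = ‖u‖ * ‖w‖
  pairing_symm : ∀ α β, ∀ x ∈ U α ∩ U β, ∀ u w, pairing β α x w u = pairing α β x u w
  smooth_pairing : ∀ α β i j, ContMDiffOn 𝓘(ℝ, E) 𝓘(ℝ, ℂ) ∞
    (fun x => pairing α β x ((L α β).frame i x) ((L β α).frame j x))
    ((L α β).dom i ∩ (L β α).dom j)
  parallel_pairing : ∀ α β i j, ∀ x ∈ (L α β).dom i ∩ (L β α).dom j,
    HasDLog E (fun x => pairing α β x ((L α β).frame i x) ((L β α).frame j x)) x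
      (fun v => (L α β).A i x ![v] + (L β α).A j x ![v])
  /-- the sections of `L α β ⊗ L β γ ⊗ L γ α` on the triple intersections: they are smooth, of
  unit length and parallel -/
  θ : ∀ α β γ x, (L α β).Fibre x ⊗[ℂ] ((L β γ).Fibre x ⊗[ℂ] (L γ α).Fibre x)
  smooth_parallel_θ : ∀ α β γ i j k, ∃ f : B → ℂ,
    ContMDiffOn 𝓘(ℝ, E) 𝓘(ℝ, ℂ) ∞ f ((L α β).dom i ∩ (L β γ).dom j ∩ (L γ α).dom k) ∧
    ∀ x ∈ (L α β).dom i ∩ (L β γ).dom j ∩ (L γ α).dom k,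
      θ α β γ x = f x • ((L α β).frame i x ⊗ₜ ((L β γ).frame j x ⊗ₜ (L γ α).frame k x)) ∧
      ‖f x‖ = 1 ∧
      HasDLog E f x (fun v => -((L α β).A i x ![v] + (L β γ).A j x ![v] + (L γ α).A k x ![v]))
  /-- `θ β γ α = θ α β γ` -/
  θ_cyclic : ∀ α β γ, ∀ x ∈ U α ∩ U β ∩ U γ, ∀ (z : ℂ) (ab : (L α β).Fibre x)
    (bc : (L β γ).Fibre x) (ca : (L γ α).Fibre x),
    θ α β γ x = z • (ab ⊗ₜ (bc ⊗ₜ ca)) → θ β γ α x = z • (bc ⊗ₜ (ca ⊗ₜ ab))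
  /-- `θ α γ β = (θ α β γ)⁻¹` -/
  θ_swap : ∀ α β γ, ∀ x ∈ U α ∩ U β ∩ U γ, ∀ (z z' : ℂ) (ab : (L α β).Fibre x)
    (ba : (L β α).Fibre x) (bc : (L β γ).Fibre x) (cb : (L γ β).Fibre x)
    (ca : (L γ α).Fibre x) (ac : (L α γ).Fibre x),
    pairing α β x ab ba = 1 → pairing β γ x bc cb = 1 → pairing γ α x ca ac = 1 →
    θ α β γ x = z • (ab ⊗ₜ (bc ⊗ₜ ca)) → θ α γ β x = z' • (ac ⊗ₜ (cb ⊗ₜ ba)) → z * z' = 1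
  /-- `θ β γ δ * (θ α γ δ)⁻¹ * θ α β δ * (θ α β γ)⁻¹ = 1` -/
  θ_cocycle : ∀ α β γ δ, ∀ x ∈ U α ∩ U β ∩ U γ ∩ U δ, ∀ (z₁ z₂ z₃ z₄ : ℂ)
    (ab : (L α β).Fibre x) (bc : (L β γ).Fibre x) (cd : (L γ δ).Fibre x) (da : (L δ α).Fibre x)
    (ac : (L α γ).Fibre x) (ca : (L γ α).Fibre x) (bd : (L β δ).Fibre x) (db : (L δ β).Fibre x),
    ab ≠ 0 → bc ≠ 0 → cd ≠ 0 → da ≠ 0 → pairing α γ x ac ca = 1 → pairing β δ x bd db = 1 →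
    θ β γ δ x = z₁ • (bc ⊗ₜ (cd ⊗ₜ db)) → θ α γ δ x = z₂ • (ac ⊗ₜ (cd ⊗ₜ da)) →
    θ α β δ x = z₃ • (ab ⊗ₜ (bd ⊗ₜ da)) → θ α β γ x = z₄ • (ab ⊗ₜ (bc ⊗ₜ ca)) →
    z₁ * z₂⁻¹ * z₃ * z₄⁻¹ = 1
  /-- the curving: real 2-forms with `F β - F α = c₁(∇^{L α β})` -/
  F : Idx → Form E B ℝ 2
  smooth_F : ∀ α, (F α).SmoothOn (U α)
  F_sub_F : ∀ α β i, ∀ x ∈ (L α β).dom i, ∀ v w : Tan E x,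
    (F β x ![v, w] : ℂ) - (F α x ![v, w] : ℂ) = (L α β).chernForm i x ![v, w]

namespace GerbeWithConnection

variable {E B} (G : GerbeWithConnection.{uE, uB, uF, uK, uI} E B)

/-- The curvature `R^G` of `G`: the 3-form on `B` which restricts to `dF α` on every `U α`. -/
def curvature : Form E B ℝ 3 := fun x => (G.F (Classical.choose (G.exists_mem_U x))).d x

/-- The multiplication `L α β ⊗ L β γ → L α γ` given by `θ`: the contraction of
`θ α γ β ∈ L α γ ⊗ L γ β ⊗ L β α` with elements of `L α β` and `L β γ`. Equivalently, `u v = w` iff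
`θ α β γ = u ⊗ v ⊗ w*`, where `w* ∈ L γ α` is dual to `w`. -/
def mul (α β γ : G.Idx) (x : B) (u : (G.L α β).Fibre x) (v : (G.L β γ).Fibre x) :
    (G.L α γ).Fibre x :=
  TensorProduct.rid ℂ _ (TensorProduct.map LinearMap.id
    (LinearMap.mul' ℂ ℂ ∘ₗ TensorProduct.map (G.pairing β γ x v) (G.pairing α β x u))
    (G.θ α γ β x))

/-- All elements of all the lines. -/
abbrev Total : Type _ := (α : G.Idx) × (β : G.Idx) × (x : B) × (G.L α β).Fibre x

/-- An element of a line `L α β` at the point `x`. -/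
abbrev pt {α β : G.Idx} {x : B} (u : (G.L α β).Fibre x) : G.Total := ⟨α, β, x, u⟩

/-- `p` is the element `1` of the canonically trivial line `L α α` at some point, i.e. the nonzero
element `e` with `e e = e`. -/
def IsOne (p : G.Total) : Prop :=
  ∃ (α : G.Idx) (x : B) (e : (G.L α α).Fibre x), p = G.pt e ∧ e ≠ 0 ∧ G.mul α α α x e e = e

end GerbeWithConnection

end Gerbes

section Loops

variable (E : Type*) [NormedAddCommGroup E] [NormedSpace ℝ E]
variable (B : Type*) [TopologicalSpace B] [ChartedSpace E B]

/-- The free loop space `LB`: smooth maps `S¹ = ℝ/ℤ → B`, i.e. smooth 1-periodic maps `ℝ → B`. -/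
structure Loop where
  toFun : ℝ → B
  smooth : ContMDiff 𝓘(ℝ, ℝ) 𝓘(ℝ, E) ∞ toFun
  periodic : Function.Periodic toFun 1

instance : CoeFun (Loop E B) (fun _ => ℝ → B) := ⟨Loop.toFun⟩

variable {E B}

/-- A smooth map `P → LB`, for a normed space `P`: a map such that `(p, t) ↦ σ(p)(t)` is smooth. -/
def SmoothFamily {P : Type*} [NormedAddCommGroup P] [NormedSpace ℝ P] (σ : P → Loop E B) : Prop :=
  ContMDiff 𝓘(ℝ, P × ℝ) 𝓘(ℝ, E) ∞ (fun q : P × ℝ => σ q.1 q.2)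

/-- Vector fields along the loop `γ`. The tangent space of `LB` at `γ` consists of the smooth
1-periodic ones. -/
abbrev LoopTan (γ : Loop E B) : Type _ := ∀ t : ℝ, Tan E (γ t)

/-- The derivative of a map `σ : P → LB` at `p` in the direction `e`, a tangent vector of `LB`. -/
def pderiv {P : Type*} [NormedAddCommGroup P] [NormedSpace ℝ P] (σ : P → Loop E B) (p e : P) :
    LoopTan (σ p) := fun t =>
  (mfderiv 𝓘(ℝ, P) 𝓘(ℝ, E) (fun q => σ q t) p : P →L[ℝ] Tan E (σ p t)) e

/-- Differential forms on `LB` with values in `ℂ`, as functions of tangent vectors. -/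
abbrev LoopForm (E B : Type*) [NormedAddCommGroup E] [NormedSpace ℝ E] [TopologicalSpace B]
    [ChartedSpace E B] (k : ℕ) : Type _ := ∀ γ : Loop E B, (Fin k → LoopTan γ) → ℂ

/-- The transgression `T η = ∫_{S¹} i_{∂t} ev^* η dt` of a real form on `B`. -/
def transgressForm {k : ℕ} (η : Form E B ℝ (k + 1)) : LoopForm E B k := fun γ X =>
  ((∫ t in (0 : ℝ)..1, η (γ t) (Fin.cons (velocity E γ t) (fun j => X j t)) : ℝ) : ℂ)

/-- The data which describe a Hermitian line bundle with connection over `LB` through its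
restrictions to the members of a covering: the covering `dom`, the restricted line bundles
`Fibre j`, with their unit vectors and smooth sections (along smooth 2-parameter families of loops),
the identifications of the fibres over the intersections, and the parallel transport
of the restricted bundles along smooth paths in `LB`. -/
structure LoopLineBundle (E B : Type*) [NormedAddCommGroup E] [NormedSpace ℝ E]
    [TopologicalSpace B] [ChartedSpace E B] where
  Idx : Type*
  dom : Idx → Set (Loop E B)
  Fibre : Idx → Loop E B → Type*
  [addCommGroup : ∀ j γ, AddCommGroup (Fibre j γ)]
  [module : ∀ j γ, Module ℂ (Fibre j γ)]
  finrank_fibre : ∀ j γ, Module.finrank ℂ (Fibre j γ) = 1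
  IsUnitVector : ∀ j γ, Fibre j γ → Prop
  IsSmooth : ∀ j (σ : ℝ × ℝ → Loop E B), (∀ p, Fibre j (σ p)) → Prop
  glue : ∀ γ, Setoid (Σ j : {j // γ ∈ dom j}, Fibre j γ)
  transport : ∀ j (Γ : ℝ → Loop E B) (a b : ℝ), Fibre j (Γ a) →ₗ[ℂ] Fibre j (Γ b)

attribute [instance] LoopLineBundle.addCommGroup LoopLineBundle.module

namespace LoopLineBundle

variable (P : LoopLineBundle E B)

/-- The covariant derivative `∇_{∂x} v` at `x₀`, of a section `v` along the path `Γ`, is `w`: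
the derivative at `x₀` of the curve `x ↦ (transport from Γ(x) to Γ(x₀)) (v x)` in the line at
`Γ(x₀)` is `w`. (The derivative is tested with the linear functionals on the line.) -/
def HasCovDerivAt (j : P.Idx) (Γ : ℝ → Loop E B) (v : ∀ x, P.Fibre j (Γ x)) (x₀ : ℝ)
    (w : P.Fibre j (Γ x₀)) : Prop :=
  ∀ ℓ : Module.Dual ℂ (P.Fibre j (Γ x₀)),
    HasDerivAt (fun x => ℓ (P.transport j Γ x x₀ (v x))) (ℓ w) x₀

/-- The 2-form `Ω` is the curvature of `P`: the members of the covering cover `LB`, and on each of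
them `∇_x ∇_y v - ∇_y ∇_x v = Ω(∂_x σ, ∂_y σ) v` for all smooth 2-parameter families `σ` of loops and
all smooth sections `v` along `σ`, the covariant derivatives in question being defined. Every pair
of tangent vectors of `LB` at a loop is `(∂_x σ, ∂_y σ)` for some such family, so `Ω` is determined
on tangent vectors; as curvature is local, nothing has to be said about the identifications. -/
def IsCurvature (Ω : LoopForm E B 2) : Prop :=
  (∀ γ, ∃ j, γ ∈ P.dom j) ∧
  ∀ j (σ : ℝ × ℝ → Loop E B), SmoothFamily σ → (∀ p, σ p ∈ P.dom j) →
    ∀ v : ∀ p, P.Fibre j (σ p), P.IsSmooth j σ v →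
    ∃ v₁ v₂ v₁₂ v₂₁ : ∀ p, P.Fibre j (σ p), ∀ x y : ℝ,
      P.HasCovDerivAt j (fun x => σ (x, y)) (fun x => v (x, y)) x (v₁ (x, y)) ∧
      P.HasCovDerivAt j (fun y => σ (x, y)) (fun y => v (x, y)) y (v₂ (x, y)) ∧
      P.HasCovDerivAt j (fun x => σ (x, y)) (fun x => v₂ (x, y)) x (v₁₂ (x, y)) ∧
      P.HasCovDerivAt j (fun y => σ (x, y)) (fun y => v₁ (x, y)) y (v₂₁ (x, y)) ∧
      v₁₂ (x, y) - v₂₁ (x, y) =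
        Ω (σ (x, y)) ![pderiv σ (x, y) (1, 0), pderiv σ (x, y) (0, 1)] • v (x, y)

end LoopLineBundle

end Loops

section Transgression

/-- The index `(n, t, s)` of a member of the covering of `LB`. The monotone map `t : ℤ/n → S¹` is
given by its lift `t : ℤ → ℝ`, and `s : ℤ/n → I` by the corresponding `n`-periodic map on `ℤ`.
(The conditions on `t` imply `n ≠ 0`.) -/
structure LoopChart (I : Type*) where
  n : ℕ
  t : ℤ → ℝ
  s : ℤ → I
  mono : Monotone t
  t_add : ∀ i, t (i + n) = t i + 1
  s_add : ∀ i, s (i + n) = s i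

/-- The index `(n, t, s')`. -/
def LoopChart.reindex {I : Type*} (c : LoopChart I) (s' : ℤ → I) (hs' : ∀ i, s' (i + c.n) = s' i) :
    LoopChart I :=
  { c with s := s', s_add := hs' }

namespace GerbeWithConnection

variable {E : Type uE} [NormedAddCommGroup E] [NormedSpace ℝ E]
variable {B : Type uB} [TopologicalSpace B] [ChartedSpace E B]
variable (G : GerbeWithConnection.{uE, uB, uF, uK, uI} E B)

/-- The set `V(t, s)` of all loops `γ` with `γ([t(i), t(i+1)]) ⊆ U_{s(i-1)} ∩ U_{s(i)}` for all `i`. -/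
def loopDom (c : LoopChart G.Idx) : Set (Loop E B) :=
  {γ | ∀ i, ∀ τ ∈ Icc (c.t i) (c.t (i + 1)), γ τ ∈ G.U (c.s (i - 1)) ∩ G.U (c.s i)}

/-- The line `L_{s(i-1) s(i)}(γ(t(i)))`. -/
abbrev factor (c : LoopChart G.Idx) (γ : Loop E B) (i : ℤ) : Type _ :=
  (G.L (c.s (i - 1)) (c.s i)).Fibre (γ (c.t i))

/-- The fibre at `γ` of the transgressed line bundle over `V(t, s)`: the tensor product over
`i ∈ ℤ/n` of the lines `L_{s(i-1) s(i)}(γ(t(i)))`. -/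
abbrev loopFibre (c : LoopChart G.Idx) (γ : Loop E B) : Type _ :=
  ⨂[ℂ] i : Fin c.n, G.factor c γ ((i : ℕ) : ℤ)

theorem finrank_loopFibre (c : LoopChart G.Idx) (γ : Loop E B) :
    Module.finrank ℂ (G.loopFibre c γ) = 1 := by
  have b : ∀ i : Fin c.n, Module.Basis Unit ℂ (G.factor c γ ((i : ℕ) : ℤ)) := fun i =>
    Module.basisUnique Unit ((G.L _ _).finrank_fibre _)
  rw [Module.finrank_eq_card_basis (Basis.piTensorProduct b)]
  simp

/-- The element `⊗ u(i)` of the fibre. -/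
def loopTensor {c : LoopChart G.Idx} {γ : Loop E B} (u : ∀ i : ℤ, G.factor c γ i) :
    G.loopFibre c γ :=
  PiTensorProduct.tprod ℂ fun i : Fin c.n => u ((i : ℕ) : ℤ)

/-- The family `u` comes from a family indexed by `ℤ/n`. -/
def IsPeriodic {c : LoopChart G.Idx} {γ : Loop E B} (u : ∀ i : ℤ, G.factor c γ i) : Prop :=
  ∀ i, G.pt (u (i + c.n)) = G.pt (u i)

/-- The two types of transition maps at the loop `γ`, as relations between elements of the fibres.

* Change of `s`: the tensor products `⊗ u(i)` and `⊗ u'(i)` correspond to each other if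
  `u(i) w(i)(t(i)) = w(i-1)(t(i)) u'(i)` in `L_{s(i-1) s'(i)}(γ(t(i)))`, where the `w(i)` are nonzero
  parallel sections of `L_{s(i) s'(i)}` along the restriction of `γ` to `[t(i), t(i+1)]`.
* Refinement: `(t, s)` is refined by `(t', s')` through `r`. The factor of the fine product at
  `r(j)` is equal to the factor of the coarse product at `j`, and the other factors of the fine
  product are the elements `1` of the trivial lines `L_{αα}`. -/
inductive Transition (γ : Loop E B) :
    ∀ c c' : LoopChart G.Idx, G.loopFibre c γ → G.loopFibre c' γ → Prop
  | change (c : LoopChart G.Idx) (s' : ℤ → G.Idx) (hs' : ∀ i, s' (i + c.n) = s' i)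
      (u : ∀ i, G.factor c γ i) (u' : ∀ i, G.factor (c.reindex s' hs') γ i)
      (w : ∀ (i : ℤ) (τ : ℝ), (G.L (c.s i) (s' i)).Fibre (γ τ))
      (hu : G.IsPeriodic u) (hu' : G.IsPeriodic u')
      (hw : ∀ i τ, G.pt (w (i + c.n) (τ + 1)) = G.pt (w i τ))
      (parallel : ∀ i, (G.L (c.s i) (s' i)).IsParallel γ (Icc (c.t i) (c.t (i + 1))) (w i))
      (ne_zero : ∀ i, w i (c.t i) ≠ 0)
      (eq : ∀ i, G.mul (c.s (i - 1)) (c.s i) (s' i) (γ (c.t i)) (u i) (w i (c.t i)) =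
        G.mul (c.s (i - 1)) (s' (i - 1)) (s' i) (γ (c.t i)) (w (i - 1) (c.t i)) (u' i)) :
      Transition γ c (c.reindex s' hs') (G.loopTensor u) (G.loopTensor u')
  | refine (c c' : LoopChart G.Idx) (r : ℤ → ℤ) (hr : StrictMono r)
      (r_add : ∀ i, r (i + c.n) = r i + c'.n) (ht : ∀ j, c.t j = c'.t (r j))
      (hs : ∀ i j, r j ≤ i → i < r (j + 1) → c'.s i = c.s j)
      (u : ∀ i, G.factor c γ i) (u' : ∀ i, G.factor c' γ i)
      (hu : G.IsPeriodic u) (hu' : G.IsPeriodic u')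
      (eq : ∀ j, G.pt (u' (r j)) = G.pt (u j))
      (one : ∀ i, i ∉ range r → G.IsOne (G.pt (u' i))) :
      Transition γ c' c (G.loopTensor u') (G.loopTensor u)

/-- The correction factor
`∏ᵢ exp(2πi ∫_{[a,b] × [t(i), t(i+1)]} Γ^* F_{s(i)})` of the parallel transport. In accordance with the
definition of the transgression of forms, `Γ^* F` is evaluated on `(∂_t, ∂_x)`, where `x ∈ [a, b]`
and `t ∈ S¹`, i.e. the factor is
`exp(2πi ∫_a^b β(∂_x Γ) dx)` for the 1-form `β = ∑ᵢ ∫_{[t(i), t(i+1)]} i_{∂t} ev^* F_{s(i)} dt`. -/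
def loopFactor (c : LoopChart G.Idx) (Γ : ℝ → Loop E B) (a b : ℝ) : ℂ :=
  ∏ i : Fin c.n, Complex.exp (2 * Real.pi * Complex.I *
    ((∫ x in a..b, ∫ τ in (c.t ((i : ℕ) : ℤ))..(c.t (((i : ℕ) : ℤ) + 1)),
      G.F (c.s ((i : ℕ) : ℤ)) (Γ x τ) ![velocity E (Γ x) τ, pderiv Γ x 1 τ] : ℝ) : ℂ))

/-- The transgression `T(G)` of a gerbe with connection, a Hermitian line bundle with connection
over `LB`. -/
def transgression : LoopLineBundle E B where
  Idx := LoopChart G.Idx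
  dom := G.loopDom
  Fibre := G.loopFibre
  finrank_fibre := G.finrank_loopFibre
  IsUnitVector c γ z := ∃ u : ∀ i : Fin c.n, G.factor c γ ((i : ℕ) : ℤ),
    (∀ i, ‖u i‖ = 1) ∧ z = PiTensorProduct.tprod ℂ u
  IsSmooth c σ v := ∀ (p : ℝ × ℝ)
    (k : ∀ i : Fin c.n, (G.L (c.s (((i : ℕ) : ℤ) - 1)) (c.s ((i : ℕ) : ℤ))).FrameIdx),
    (∀ i, σ p (c.t ((i : ℕ) : ℤ)) ∈ (G.L _ _).dom (k i)) →
    ∃ f : ℝ × ℝ → ℂ, ContDiffAt ℝ ∞ f p ∧ ∀ᶠ q in 𝓝 p,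
      v q = f q • PiTensorProduct.tprod ℂ fun i : Fin c.n =>
        (G.L _ _).frame (k i) (σ q (c.t ((i : ℕ) : ℤ)))
  glue γ := Relation.EqvGen.setoid fun z z' => G.Transition γ z.1 z'.1 z.2 z'.2
  transport c Γ a b := G.loopFactor c Γ a b • PiTensorProduct.map fun i : Fin c.n =>
    (G.L (c.s (((i : ℕ) : ℤ) - 1)) (c.s ((i : ℕ) : ℤ))).transport
      (fun x => Γ x (c.t ((i : ℕ) : ℤ))) a b

end GerbeWithConnection

end Transgression

end GerbeTransgression
end

/-!
Over a family `σ` of loops in `V(t, s)`, local frames `kᵢ` of the bundles `L_{s(i-1) s(i)}` near the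
points `σ(t(i))` give a section `⊗ᵢ frame(kᵢ)` of the transgressed bundle. Parallel transport along a
short path multiplies a frame by `exp(-∫ A)` (`HermLineBundle.transport_frame`), so differentiating
the parallel transport of `T(G)` shows that its connection form with respect to this section is
`∑ᵢ ev_{t(i)}^* A_{kᵢ} - 2πi β` with `β = ∑ᵢ ∫_{[t(i), t(i+1)]} i_{∂t} ev^* F_{s(i)} dt`
(`GerbeWithConnection.hasCovDerivAt_frameTensor`). As the bundle has rank one, the commutator
of the covariant derivatives is multiplication by the exterior derivative of this form.

By Stokes' theorem on `[t(i), t(i+1)]`, `dβ` consists of `-∫_{S¹} i_{∂t} ev^* R^G dt` and of boundary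
terms (`GerbeWithConnection.integral_curvature_interval`). A shift of the index turns the latter into
`∑ᵢ ev_{t(i)}^* (F_{s(i-1)} - F_{s(i)})`, minus the sum of the Chern forms of the bundles
`L_{s(i-1) s(i)}` (`GerbeWithConnection.sum_boundary_terms`), and `-2πi` times this sum cancels the
curvatures `ev_{t(i)}^* dA_{kᵢ}`. What is left is `2πi T(R^G)`
(`GerbeWithConnection.curvature_connectionForm`).

All forms are handled through their pull-backs along maps from normed spaces, on which Mathlib's
`extDeriv` is available. The compatibility of `Form.d` with pull-backs (`Form.extDeriv_pull`) also
shows that `Form.d` does not depend on charts, hence that the curvature of a gerbe is `dF α` on all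
of `U α` (`GerbeWithConnection.curvature_eq`). That the sets `V(t, s)` cover the loop space follows
from Lebesgue's number lemma (`exists_subdivision`).
-/

noncomputable section

namespace GerbeTransgression

universe uE uB uF uK uI

/-! ### Pull-backs of differential forms to normed spaces -/

section Pullback

variable {E : Type*} [NormedAddCommGroup E] [NormedSpace ℝ E]
variable {B : Type*} [TopologicalSpace B] [ChartedSpace E B]
variable {F : Type*} [NormedAddCommGroup F] [NormedSpace ℝ F] {k : ℕ}
variable {M : Type*} [NormedAddCommGroup M] [NormedSpace ℝ M]
variable {N : Type*} [NormedAddCommGroup N] [NormedSpace ℝ N]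

/-- The differential at `m` of a map `Φ : M → B` from a normed space, as a map into the model space
`E`, to which every tangent space of `B` is definitionally equal. -/
def modelDeriv (Φ : M → B) (m : M) : M →L[ℝ] E :=
  mfderiv 𝓘(ℝ, M) 𝓘(ℝ, E) Φ m

/-- The form `η` at the point `x`, seen as a form on the model space. -/
def Form.onModel (η : Form E B F k) (x : B) : E [⋀^Fin k]→L[ℝ] F := η x

/-- The pull-back `Φ^* η` of a form on `B` under a map `Φ : M → B` from a normed space. -/
def Form.pull (η : Form E B F k) (Φ : M → B) (m : M) : M [⋀^Fin k]→L[ℝ] F :=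
  (η.onModel (Φ m)).compContinuousLinearMap (modelDeriv Φ m)

theorem Form.inChart_eq_pull (η : Form E B F k) (x₀ : B) :
    Form.inChart η x₀ = η.pull (chartAt E x₀).symm := rfl

theorem modelDeriv_comp {Φ : M → B} {φ : N → M} {q : N}
    (hΦ : MDifferentiableAt 𝓘(ℝ, M) 𝓘(ℝ, E) Φ (φ q)) (hφ : DifferentiableAt ℝ φ q) :
    (modelDeriv (fun q => Φ (φ q)) q : N →L[ℝ] E) =
      (modelDeriv Φ (φ q) : M →L[ℝ] E).comp (fderiv ℝ φ q) := by
  have h := mfderiv_comp q hΦ hφ.mdifferentiableAt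
  rw [mfderiv_eq_fderiv] at h
  exact h

theorem Form.pull_comp (η : Form E B F k) {Φ : M → B} {φ : N → M} {q : N}
    (hΦ : MDifferentiableAt 𝓘(ℝ, M) 𝓘(ℝ, E) Φ (φ q)) (hφ : DifferentiableAt ℝ φ q) :
    η.pull (fun q => Φ (φ q)) q =
      (η.pull Φ (φ q)).compContinuousLinearMap (fderiv ℝ φ q) := by
  unfold Form.pull
  rw [modelDeriv_comp hΦ hφ]
  rfl

theorem _root_.Filter.EventuallyEq.modelDeriv_eq {Φ Ψ : M → B} {m : M} (h : Φ =ᶠ[𝓝 m] Ψ) :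
    (modelDeriv Φ m : M →L[ℝ] E) = modelDeriv Ψ m :=
  h.mfderiv_eq

theorem Form.contDiffAt_inChart {η : Form E B F k} {U : Set B} (hη : η.SmoothOn U) (hU : IsOpen U)
    {x₀ x : B} (hx : x ∈ (chartAt E x₀).source) (hxU : x ∈ U) :
    ContDiffAt ℝ ∞ (Form.inChart η x₀) (chartAt E x₀ x) := by
  refine (hη x₀).contDiffAt (IsOpen.mem_nhds ?_ ⟨(chartAt E x₀).map_source hx, ?_⟩)
  · exact (chartAt E x₀).isOpen_inter_preimage_symm hU
  · rwa [mem_preimage, (chartAt E x₀).left_inv hx]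

/-- A continuous alternating map depends smoothly on the map and its arguments. -/
theorem contDiffAt_alternating_apply {κ : M → E [⋀^Fin k]→L[ℝ] F} {u : Fin k → M → E} {m : M}
    (hκ : ContDiffAt ℝ ∞ κ m) (hu : ∀ i, ContDiffAt ℝ ∞ (u i) m) :
    ContDiffAt ℝ ∞ (fun m => κ m (fun i => u i m)) m := by
  have h := (ContinuousLinearMap.cpolynomialAt_uncurry_of_multilinear
    (ContinuousAlternatingMap.toContinuousMultilinearMapCLM ℝ :
      (E [⋀^Fin k]→L[ℝ] F) →L[ℝ] _) (x := (κ m, fun i => u i m))).contDiffAt (n := ∞)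
  exact h.comp m (hκ.prodMk (contDiffAt_pi.2 hu))

theorem eventually_contMDiffAt {Φ : M → B} {O : Set M} (hO : IsOpen O)
    (hΦ : ContMDiffOn 𝓘(ℝ, M) 𝓘(ℝ, E) ∞ Φ O) {m : M} (hm : m ∈ O) :
    ∀ᶠ m' in 𝓝 m, ContMDiffAt 𝓘(ℝ, M) 𝓘(ℝ, E) ∞ Φ m' := by
  filter_upwards [hO.mem_nhds hm] with m' hm'
  exact (hΦ m' hm').contMDiffAt (hO.mem_nhds hm')

variable [IsManifold 𝓘(ℝ, E) ∞ B]

theorem contMDiffAt_chart_comp {Φ : M → B} {m : M} {x₀ : B}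
    (hΦ : ContMDiffAt 𝓘(ℝ, M) 𝓘(ℝ, E) ∞ Φ m) (hm : Φ m ∈ (chartAt E x₀).source) :
    ContDiffAt ℝ ∞ (fun m => chartAt E x₀ (Φ m)) m := by
  rw [← contMDiffAt_iff_contDiffAt]
  have h := contMDiffOn_chart (I := 𝓘(ℝ, E)) (n := ∞) (x := x₀)
  exact ((h _ hm).contMDiffAt ((chartAt E x₀).open_source.mem_nhds hm)).comp m hΦ

/-- The pull-back of a form in terms of its representation in a chart. -/
theorem Form.pull_eq_inChart (η : Form E B F k) {Φ : M → B} {m : M} {x₀ : B}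
    (hΦ : ContMDiffAt 𝓘(ℝ, M) 𝓘(ℝ, E) ∞ Φ m) (hm : Φ m ∈ (chartAt E x₀).source) :
    η.pull Φ m = (Form.inChart η x₀ (chartAt E x₀ (Φ m))).compContinuousLinearMap
      (fderiv ℝ (fun m => chartAt E x₀ (Φ m)) m) := by
  set e := chartAt E x₀
  have hnear : Φ =ᶠ[𝓝 m] fun m' => e.symm (e (Φ m')) := by
    filter_upwards [hΦ.continuousAt.preimage_mem_nhds (e.open_source.mem_nhds hm)] with m' hm'
    exact (e.left_inv hm').symm
  have hsymm : MDifferentiableAt 𝓘(ℝ, E) 𝓘(ℝ, E) e.symm (e (Φ m)) := by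
    have h := contMDiffOn_chart_symm (I := 𝓘(ℝ, E)) (n := ∞) (x := x₀)
    exact ((h _ (e.map_source hm)).contMDiffAt
      (e.open_target.mem_nhds (e.map_source hm))).mdifferentiableAt (by simp)
  have hψ : DifferentiableAt ℝ (fun m => e (Φ m)) m :=
    (contMDiffAt_chart_comp hΦ hm).differentiableAt (by simp)
  rw [Form.inChart_eq_pull, ← Form.pull_comp η (Φ := e.symm) (φ := fun m => e (Φ m)) hsymm hψ]
  unfold Form.pull
  rw [hnear.modelDeriv_eq]
  exact congrArg (fun b => (η.onModel b).compContinuousLinearMap _) hnear.eq_of_nhds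

theorem Form.pull_eventuallyEq (η : Form E B F k) {Φ : M → B} {O : Set M} (hO : IsOpen O)
    (hΦ : ContMDiffOn 𝓘(ℝ, M) 𝓘(ℝ, E) ∞ Φ O) {m : M} (hm : m ∈ O) :
    η.pull Φ =ᶠ[𝓝 m] fun m' =>
      (Form.inChart η (Φ m) (chartAt E (Φ m) (Φ m'))).compContinuousLinearMap
        (fderiv ℝ (fun m' => chartAt E (Φ m) (Φ m')) m') := by
  have h := eventually_contMDiffAt hO hΦ hm
  have hs := h.self_of_nhds.continuousAt.preimage_mem_nhds
    ((chartAt E (Φ m)).open_source.mem_nhds (mem_chart_source E (Φ m)))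
  filter_upwards [h, hs] with m' h' hs'
  exact η.pull_eq_inChart h' hs'

theorem Form.differentiableAt_pull {η : Form E B F k} {U : Set B} (hη : η.SmoothOn U)
    (hU : IsOpen U) {Φ : M → B} {O : Set M} (hO : IsOpen O)
    (hΦ : ContMDiffOn 𝓘(ℝ, M) 𝓘(ℝ, E) ∞ Φ O) {m : M} (hm : m ∈ O) (hmU : Φ m ∈ U) :
    DifferentiableAt ℝ (η.pull Φ) m := by
  refine DifferentiableAt.congr_of_eventuallyEq ?_ (η.pull_eventuallyEq hO hΦ hm)
  have hx := mem_chart_source E (Φ m)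
  have hψ := contMDiffAt_chart_comp ((hΦ m hm).contMDiffAt (hO.mem_nhds hm)) hx
  refine DifferentiableAt.continuousAlternatingMapCompContinuousLinearMap ?_ ?_
  · exact ((Form.contDiffAt_inChart hη hU hx hmU).comp m hψ).differentiableAt (by simp)
  · exact (hψ.fderiv_right (m := 1) (by norm_cast)).differentiableAt (by simp)

theorem Form.contDiffAt_pull_apply {η : Form E B F k} {U : Set B} (hη : η.SmoothOn U)
    (hU : IsOpen U) {Φ : M → B} {O : Set M} (hO : IsOpen O)
    (hΦ : ContMDiffOn 𝓘(ℝ, M) 𝓘(ℝ, E) ∞ Φ O) {m : M} (hm : m ∈ O) (hmU : Φ m ∈ U)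
    (v : Fin k → M) :
    ContDiffAt ℝ ∞ (fun m => η.pull Φ m v) m := by
  have h := (η.pull_eventuallyEq hO hΦ hm).fun_comp
    (fun κ : M [⋀^Fin k]→L[ℝ] F => κ v)
  refine ContDiffAt.congr_of_eventuallyEq ?_ h
  have hx := mem_chart_source E (Φ m)
  have hψ := contMDiffAt_chart_comp ((hΦ m hm).contMDiffAt (hO.mem_nhds hm)) hx
  refine contDiffAt_alternating_apply
    (κ := fun m' => Form.inChart η (Φ m) (chartAt E (Φ m) (Φ m'))) (u := fun i m' =>
    fderiv ℝ (fun m' => chartAt E (Φ m) (Φ m')) m' (v i)) ?_ fun i => ?_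
  · exact (Form.contDiffAt_inChart hη hU hx hmU).comp m hψ
  · exact (hψ.fderiv_right (m := ∞) (by simp)).clm_apply contDiffAt_const

/-- The exterior derivative commutes with pull-backs. For the inverse of a chart this says that
`Form.d` may be computed in any chart. -/
theorem Form.extDeriv_pull {η : Form E B F k} {U : Set B} (hη : η.SmoothOn U)
    (hU : IsOpen U) {Φ : M → B} {O : Set M} (hO : IsOpen O)
    (hΦ : ContMDiffOn 𝓘(ℝ, M) 𝓘(ℝ, E) ∞ Φ O) {m : M} (hm : m ∈ O) (hmU : Φ m ∈ U) :
    extDeriv (η.pull Φ) m = η.d.pull Φ m := by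
  rw [(η.pull_eventuallyEq hO hΦ hm).extDeriv_eq]
  have hx := mem_chart_source E (Φ m)
  have hΦm := (hΦ m hm).contMDiffAt (hO.mem_nhds hm)
  have hψ := contMDiffAt_chart_comp hΦm hx
  have hκ := (Form.contDiffAt_inChart hη hU hx hmU).differentiableAt (by simp)
  rw [extDeriv_pullback (f := fun m' => chartAt E (Φ m) (Φ m')) hκ hψ (by simp; norm_cast)]
  have hchart : MDifferentiableAt 𝓘(ℝ, E) 𝓘(ℝ, E) (chartAt E (Φ m)) (Φ m) := by
    have h := contMDiffOn_chart (I := 𝓘(ℝ, E)) (n := ∞) (x := Φ m)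
    exact ((h _ hx).contMDiffAt ((chartAt E (Φ m)).open_source.mem_nhds hx)).mdifferentiableAt
      (by simp)
  have hcomp := mfderiv_comp m hchart (hΦm.mdifferentiableAt (by simp))
  let D : E →L[ℝ] E := mfderiv 𝓘(ℝ, E) 𝓘(ℝ, E) (chartAt E (Φ m)) (Φ m)
  have : fderiv ℝ (fun m' => chartAt E (Φ m) (Φ m')) m = D.comp (modelDeriv Φ m) := by
    rw [← mfderiv_eq_fderiv]
    exact hcomp
  rw [this]
  rfl

end Pullback

/-- The exterior derivative commutes with continuous linear maps between the coefficients. -/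
theorem extDeriv_clm_comp {M F F' : Type*} [NormedAddCommGroup M] [NormedSpace ℝ M]
    [NormedAddCommGroup F] [NormedSpace ℝ F] [NormedAddCommGroup F'] [NormedSpace ℝ F'] {k : ℕ}
    (l : F →L[ℝ] F') {κ : M → M [⋀^Fin k]→L[ℝ] F} {m : M} (hκ : DifferentiableAt ℝ κ m) :
    extDeriv (fun m => l.compContinuousAlternatingMap (κ m)) m =
      l.compContinuousAlternatingMap (extDeriv κ m) := by
  have h := (((ContinuousLinearMap.compContinuousAlternatingMapCLM ℝ M F F' (Fin k)) l).hasFDerivAt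
    (x := κ m)).comp m hκ.hasFDerivAt
  have h' : HasFDerivAt (fun m => l.compContinuousAlternatingMap (κ m)) _ m := h
  ext v
  simp [extDeriv, h'.fderiv, ContinuousAlternatingMap.alternatizeUncurryFin_apply]

namespace GerbeWithConnection

variable {E : Type uE} [NormedAddCommGroup E] [NormedSpace ℝ E]
variable {B : Type uB} [TopologicalSpace B] [ChartedSpace E B]
variable {M : Type*} [NormedAddCommGroup M] [NormedSpace ℝ M]
variable (G : GerbeWithConnection.{uE, uB, uF, uK, uI} E B)

theorem pull_F_sub_F {α β : G.Idx} (i : (G.L α β).FrameIdx) {Φ : M → B} {m : M}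
    (hm : Φ m ∈ (G.L α β).dom i) (v : Fin 2 → M) :
    (((G.F β).pull Φ m v : ℝ) : ℂ) - ((G.F α).pull Φ m v : ℝ) =
      (-1 / (2 * Real.pi * Complex.I) : ℂ) * ((G.L α β).curvature i).pull Φ m v := by
  have h := G.F_sub_F α β i (Φ m) hm (modelDeriv (E := E) Φ m (v 0)) (modelDeriv (E := E) Φ m (v 1))
  have hv : (fun j => modelDeriv (E := E) Φ m (v j)) =
      ![modelDeriv Φ m (v 0), modelDeriv Φ m (v 1)] := by
    ext j
    fin_cases j <;> rfl
  have e : ∀ {F : Type _} [NormedAddCommGroup F] [NormedSpace ℝ F] (η : Form E B F 2),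
      η.pull Φ m v = η.onModel (Φ m) ![modelDeriv Φ m (v 0), modelDeriv Φ m (v 1)] := by
    intro F _ _ η
    exact congrArg (η.onModel (Φ m)) hv
  rw [e, e, e]
  exact h

variable [IsManifold 𝓘(ℝ, E) ∞ B]

/-- On double overlaps the forms `dF α` agree, since the forms `F α` differ by the closed form
`c₁(∇^{L α β})`. -/
theorem d_F_eq {α β : G.Idx} {x : B} (hα : x ∈ G.U α) (hβ : x ∈ G.U β) :
    (G.F α).d x = (G.F β).d x := by
  obtain ⟨i, hi⟩ := (G.L α β).exists_mem_dom x ⟨hα, hβ⟩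
  set e := chartAt E x
  have hx := mem_chart_source E x
  have hdom := (G.L α β).isOpen_dom i
  have hO : IsOpen (e.target ∩ e.symm ⁻¹' (G.L α β).dom i) := e.isOpen_inter_preimage_symm hdom
  have hxO : e x ∈ e.target ∩ e.symm ⁻¹' (G.L α β).dom i :=
    ⟨e.map_source hx, by rwa [mem_preimage, e.left_inv hx]⟩
  have hsm : ContMDiffOn 𝓘(ℝ, E) 𝓘(ℝ, E) ∞ e.symm e.target := contMDiffOn_chart_symm
  -- `l` is multiplication by `-1 / (2πi)`, followed by the real part
  let l : ℂ →L[ℝ] ℝ := Complex.reCLM.comp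
    ((ContinuousLinearMap.mul ℝ ℂ) (-1 / (2 * Real.pi * Complex.I)))
  have hα' := (Form.contDiffAt_inChart (G.smooth_F α) (G.isOpen_U α) hx hα)
  have hA := (Form.contDiffAt_inChart ((G.L α β).smooth_A i) hdom hx hi)
  have hnear : (fun y => (G.F β).inChart x y) =ᶠ[𝓝 (e x)] fun y => (G.F α).inChart x y +
      extDeriv (fun y => l.compContinuousAlternatingMap (((G.L α β).A i).inChart x y)) y := by
    filter_upwards [hO.mem_nhds hxO] with y hy
    have hAy : DifferentiableAt ℝ (((G.L α β).A i).inChart x) y :=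
      Form.differentiableAt_pull ((G.L α β).smooth_A i) hdom e.open_target hsm hy.1 hy.2
    have hd : extDeriv (((G.L α β).A i).inChart x) y = ((G.L α β).A i).d.pull e.symm y :=
      Form.extDeriv_pull ((G.L α β).smooth_A i) hdom e.open_target hsm hy.1 hy.2
    rw [extDeriv_clm_comp l hAy, hd]
    ext v
    have h := congrArg Complex.re (G.pull_F_sub_F i (Φ := e.symm) (m := y) hy.2 v)
    rw [Complex.sub_re, Complex.ofReal_re, Complex.ofReal_re] at h
    have h' : (G.F β).pull e.symm y v = (G.F α).pull e.symm y v +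
        l (((G.L α β).curvature i).pull e.symm y v) := by
      rw [← sub_eq_iff_eq_add']
      exact h
    exact h'
  have hlA : ContDiffAt ℝ ∞
      (fun y => l.compContinuousAlternatingMap (((G.L α β).A i).inChart x y)) (e x) :=
    ((ContinuousLinearMap.compContinuousAlternatingMapCLM ℝ E ℂ ℝ (Fin 1)) l).contDiff.contDiffAt.comp
      _ hA
  have hdlA : DifferentiableAt ℝ
      (extDeriv fun y => l.compContinuousAlternatingMap (((G.L α β).A i).inChart x y)) (e x) := by
    have h1 := (hlA.fderiv_right (m := 1) (by norm_cast)).differentiableAt (by simp)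
    exact (ContinuousAlternatingMap.alternatizeUncurryFinCLM ℝ E ℝ).differentiableAt.comp _ h1
  have key : extDeriv ((G.F β).inChart x) (e x) = extDeriv ((G.F α).inChart x) (e x) := by
    have h1 : extDeriv ((G.F β).inChart x) (e x) = _ := hnear.extDeriv_eq
    rw [h1, extDeriv_fun_add (hα'.differentiableAt (by simp)) hdlA,
      extDeriv_extDeriv_apply hlA (by simp; norm_cast), add_zero]
  unfold Form.d
  rw [key]

theorem curvature_eq {α : G.Idx} {x : B} (hα : x ∈ G.U α) : G.curvature x = (G.F α).d x :=
  G.d_F_eq (Classical.choose_spec (G.exists_mem_U x)) hα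

end GerbeWithConnection

/-! ### Parallel transport in a Hermitian line bundle -/

section PullbackApply

variable {E : Type*} [NormedAddCommGroup E] [NormedSpace ℝ E]
variable {B : Type*} [TopologicalSpace B] [ChartedSpace E B]
variable {F : Type*} [NormedAddCommGroup F] [NormedSpace ℝ F]
variable {M : Type*} [NormedAddCommGroup M] [NormedSpace ℝ M]

theorem Form.pull_apply_one (η : Form E B F 1) (Φ : M → B) (m v : M) :
    η.pull Φ m ![v] = η.onModel (Φ m) ![modelDeriv Φ m v] := by
  refine congrArg (η.onModel (Φ m)) ?_
  ext j
  fin_cases j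
  rfl

theorem Form.pull_apply_two (η : Form E B F 2) (Φ : M → B) (m v w : M) :
    η.pull Φ m ![v, w] = η.onModel (Φ m) ![modelDeriv Φ m v, modelDeriv Φ m w] := by
  refine congrArg (η.onModel (Φ m)) ?_
  ext j
  fin_cases j <;> rfl

theorem Form.pull_apply_three (η : Form E B F 3) (Φ : M → B) (m u v w : M) :
    η.pull Φ m ![u, v, w] =
      η.onModel (Φ m) ![modelDeriv Φ m u, modelDeriv Φ m v, modelDeriv Φ m w] := by
  refine congrArg (η.onModel (Φ m)) ?_
  ext j
  fin_cases j <;> rfl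

end PullbackApply

/-- The fundamental theorem of calculus for a primitive `∫ α` of a function which is continuous on
an open set containing the interval of integration. -/
theorem hasDerivAt_integral_of_continuousOn {V : Type*} [NormedAddCommGroup V] [NormedSpace ℝ V]
    [CompleteSpace V] {α : ℝ → V} {O : Set ℝ} (hO : IsOpen O) (hα : ContinuousOn α O) {a b : ℝ}
    (hab : uIcc a b ⊆ O) : HasDerivAt (fun τ => ∫ s in a..τ, α s) (α b) b := by
  have hb : b ∈ O := hab right_mem_uIcc
  exact intervalIntegral.integral_hasDerivAt_right (hα.mono hab).intervalIntegrable
    (hα.stronglyMeasurableAtFilter hO b hb) (hα.continuousAt (hO.mem_nhds hb))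

namespace HermLineBundle

variable {E : Type uE} [NormedAddCommGroup E] [NormedSpace ℝ E]
variable {B : Type uB} [TopologicalSpace B] [ChartedSpace E B]
variable {U : Set B} (L : HermLineBundle.{uE, uB, uF, uK} E U)

theorem inner_frame_frame {i : L.FrameIdx} {x : B} (hx : x ∈ L.dom i) :
    inner ℂ (L.frame i x) (L.frame i x) = 1 := by
  rw [inner_self_eq_norm_sq_to_K, L.norm_frame i x hx]
  simp

theorem inner_frame_smul_frame {i : L.FrameIdx} {x : B} (hx : x ∈ L.dom i) (u : L.Fibre x) :
    inner ℂ (L.frame i x) u • L.frame i x = u := by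
  have h0 : L.frame i x ≠ 0 := by
    rw [← norm_ne_zero_iff, L.norm_frame i x hx]
    exact one_ne_zero
  obtain ⟨z, rfl⟩ := (finrank_eq_one_iff_of_nonzero' _ h0).1 (L.finrank_fibre x) u
  rw [inner_smul_right, L.inner_frame_frame hx, mul_one]

/-- The connection form `A i`, evaluated on the velocity of the path `c`. -/
def pathForm (i : L.FrameIdx) (c : ℝ → B) (τ : ℝ) : ℂ :=
  L.A i (c τ) ![velocity E c τ]

theorem pathForm_eq_pull (i : L.FrameIdx) (c : ℝ → B) (τ : ℝ) :
    L.pathForm i c τ = (L.A i).pull c τ ![1] :=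
  ((L.A i).pull_apply_one c τ 1).symm

/-- A section which satisfies the equation of parallel transport with respect to one frame `i`
satisfies it with respect to every frame `j`: the logarithmic derivative of the transition function
makes up for the difference of `A i` and `A j`. -/
theorem isParallel_exp_smul_frame {i : L.FrameIdx} {c : ℝ → B}
    (hc : ContMDiff 𝓘(ℝ, ℝ) 𝓘(ℝ, E) ∞ c) {S : Set ℝ} (hS : ∀ τ ∈ S, c τ ∈ L.dom i) {ρ : ℝ → ℂ}
    (hρ : ∀ τ ∈ S, HasDerivAt ρ (-L.pathForm i c τ * ρ τ) τ) :
    L.IsParallel c S (fun τ => ρ τ • L.frame i (c τ)) := by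
  intro τ hτ j hj
  have hi := hS τ hτ
  set g : B → ℂ := fun x => inner ℂ (L.frame j x) (L.frame i x) with hg
  have hgd : MDifferentiableAt 𝓘(ℝ, E) 𝓘(ℝ, ℂ) g (c τ) :=
    ((L.smooth_transition i j _ ⟨hi, hj⟩).contMDiffAt
      (((L.isOpen_dom i).inter (L.isOpen_dom j)).mem_nhds ⟨hi, hj⟩)).mdifferentiableAt (by simp)
  have hcd : MDifferentiableAt 𝓘(ℝ, ℝ) 𝓘(ℝ, E) c τ := hc.mdifferentiableAt (by simp)
  have hcomp := mfderiv_comp τ hgd hcd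
  have hgc : HasDerivAt (fun τ => g (c τ))
      (g (c τ) * (L.pathForm i c τ - L.pathForm j c τ)) τ := by
    have hd : DifferentiableAt ℝ (fun τ => g (c τ)) τ :=
      mdifferentiableAt_iff_differentiableAt.1 (hgd.comp τ hcd)
    have h1 : deriv (fun τ => g (c τ)) τ = g (c τ) * (L.pathForm i c τ - L.pathForm j c τ) := by
      rw [← fderiv_apply_one_eq_deriv, ← mfderiv_eq_fderiv]
      have h2 := L.A_sub_A i j (c τ) ⟨hi, hj⟩ (velocity E c τ)
      rw [show (fun τ => g (c τ)) = g ∘ c from rfl, hcomp]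
      exact h2
    rw [← h1]
    exact hd.hasDerivAt
  have hfun : (fun τ' => inner ℂ (L.frame j (c τ')) (ρ τ' • L.frame i (c τ'))) =
      fun τ' => ρ τ' * g (c τ') := by
    funext τ'
    rw [inner_smul_right]
  have := ((hρ τ hτ).mul hgc).hasDerivWithinAt (s := S)
  rw [hfun]
  refine this.congr_deriv ?_
  rw [inner_smul_right]
  change _ = -L.pathForm j c τ * (ρ τ * g (c τ))
  ring

variable [IsManifold 𝓘(ℝ, E) ∞ B]

theorem continuousOn_pathForm (i : L.FrameIdx) {c : ℝ → B}
    (hc : ContMDiff 𝓘(ℝ, ℝ) 𝓘(ℝ, E) ∞ c) :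
    ContinuousOn (L.pathForm i c) (c ⁻¹' L.dom i) := by
  intro τ hτ
  have h := (Form.contDiffAt_pull_apply (L.smooth_A i) (L.isOpen_dom i) isOpen_univ
    hc.contMDiffOn (mem_univ τ) hτ ![1]).continuousAt.continuousWithinAt (s := c ⁻¹' L.dom i)
  rwa [← funext (L.pathForm_eq_pull i c)] at h

/-- Parallel transport along a path in the domain of a frame multiplies the frame by
`exp(-∫ A)`. -/
theorem transport_frame {i : L.FrameIdx} {c : ℝ → B} (hc : ContMDiff 𝓘(ℝ, ℝ) 𝓘(ℝ, E) ∞ c) {a b : ℝ}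
    (hab : ∀ τ ∈ uIcc a b, c τ ∈ L.dom i) :
    L.transport c a b (L.frame i (c a)) =
      Complex.exp (-∫ τ in a..b, L.pathForm i c τ) • L.frame i (c b) := by
  set α := L.pathForm i c with hα
  have hO : IsOpen (c ⁻¹' L.dom i) := (L.isOpen_dom i).preimage hc.continuous
  have hαc := L.continuousOn_pathForm i hc
  have hint : ∀ τ ∈ uIcc a b, HasDerivAt (fun τ => ∫ s in a..τ, α s) (α τ) τ := fun τ hτ =>
    hasDerivAt_integral_of_continuousOn hO hαc fun s hs =>
      hab s (uIcc_subset_uIcc left_mem_uIcc hτ hs)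
  -- `transport` is defined by choice, so the existence of a suitable map has to be shown first
  have hex : ∃ P : L.Fibre (c a) →ₗ[ℂ] L.Fibre (c b), ∀ v : ∀ τ, L.Fibre (c τ),
      L.IsParallel c (uIcc a b) v → P (v a) = v b := by
    refine ⟨(LinearMap.toSpanSingleton ℂ _
      (Complex.exp (-∫ τ in a..b, α τ) • L.frame i (c b))).comp
        (innerₛₗ ℂ (L.frame i (c a))), fun v hv => ?_⟩
    -- the coordinate of `v` times `exp(∫ A)` is constant
    have hder : ∀ τ ∈ uIcc a b, HasDerivWithinAt
        (fun τ => inner ℂ (L.frame i (c τ)) (v τ) * Complex.exp (∫ s in a..τ, α s)) 0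
        (uIcc a b) τ := by
      intro τ hτ
      have h := (hv τ hτ i (hab τ hτ)).mul ((hint τ hτ).cexp.hasDerivWithinAt (s := uIcc a b))
      refine h.congr_deriv ?_
      change -α τ * _ * _ + _ = (0 : ℂ)
      ring
    have hconst := Convex.norm_image_sub_le_of_norm_hasDerivWithin_le (C := 0) hder
      (fun _ _ => by simp) (convex_uIcc a b) (left_mem_uIcc (a := a) (b := b)) right_mem_uIcc
    rw [zero_mul, norm_le_zero_iff, sub_eq_zero] at hconst
    simp only [intervalIntegral.integral_same, Complex.exp_zero, mul_one] at hconst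
    rw [LinearMap.comp_apply, LinearMap.toSpanSingleton_apply, innerₛₗ_apply_apply, ← hconst,
      smul_smul, mul_assoc, ← Complex.exp_add, add_neg_cancel, Complex.exp_zero, mul_one,
      L.inner_frame_smul_frame (hab b right_mem_uIcc)]
  have hspec : ∀ v : ∀ τ, L.Fibre (c τ),
      L.IsParallel c (uIcc a b) v → L.transport c a b (v a) = v b := Classical.epsilon_spec hex
  have h := hspec (fun τ => Complex.exp (-∫ s in a..τ, α s) • L.frame i (c τ))
    (L.isParallel_exp_smul_frame hc hab fun τ hτ => by
      have := (hint τ hτ).neg.cexp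
      rwa [mul_comm] at this)
  simpa using h

end HermLineBundle

/-! ### The covariant derivative of the transgressed bundle -/

/-- Differentiation under the integral sign over a compact interval, for a function which is
continuously differentiable near the domain of integration. -/
theorem hasDerivAt_integral_of_contDiffAt {H : ℝ × ℝ → ℝ} {a b : ℝ}
    (hH : ∀ x, ∀ τ ∈ uIcc a b, ContDiffAt ℝ ∞ H (x, τ)) (x₀ : ℝ) :
    IntervalIntegrable (fun τ => fderiv ℝ H (x₀, τ) (1, 0)) MeasureTheory.volume a b ∧
    HasDerivAt (fun x => ∫ τ in a..b, H (x, τ)) (∫ τ in a..b, fderiv ℝ H (x₀, τ) (1, 0)) x₀ := by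
  have hc : ∀ x, ContinuousOn (fun τ => H (x, τ)) (uIcc a b) := fun x τ hτ =>
    ((hH x τ hτ).continuousAt.comp (Continuous.prodMk_right x).continuousAt).continuousWithinAt
  have hd : ∀ x, ∀ τ ∈ uIcc a b, ContinuousAt (fun q => fderiv ℝ H q (1, 0)) (x, τ) :=
    fun x τ hτ => (((hH x τ hτ).fderiv_right (m := 0) (by simp)).clm_apply
      contDiffAt_const).continuousAt
  have hd' : ContinuousOn (fun τ => fderiv ℝ H (x₀, τ) (1, 0)) (uIcc a b) := fun τ hτ =>
    ((hd x₀ τ hτ).comp (f := fun τ => (x₀, τ))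
      (Continuous.prodMk_right x₀).continuousAt).continuousWithinAt
  have hi : ∀ x, IntervalIntegrable (fun τ => H (x, τ)) MeasureTheory.volume a b := fun x =>
    (hc x).intervalIntegrable
  have hdi : IntervalIntegrable (fun τ => fderiv ℝ H (x₀, τ) (1, 0)) MeasureTheory.volume a b :=
    hd'.intervalIntegrable
  obtain ⟨C, hC⟩ := ((isCompact_closedBall x₀ 1).prod (isCompact_uIcc (a := a) (b := b))
    ).exists_bound_of_continuousOn (f := fun q => fderiv ℝ H q (1, 0))
    (fun q hq => (hd q.1 q.2 hq.2).continuousWithinAt)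
  refine intervalIntegral.hasDerivAt_integral_of_dominated_loc_of_deriv_le
    (F := fun x τ => H (x, τ)) (F' := fun x τ => fderiv ℝ H (x, τ) (1, 0)) (bound := fun _ => C)
    (Metric.closedBall_mem_nhds x₀ one_pos) (Eventually.of_forall fun x =>
      (hi x).aestronglyMeasurable_restrict_uIoc) (hi x₀) hdi.aestronglyMeasurable_restrict_uIoc
    (Eventually.of_forall fun τ hτ x hx => hC (x, τ) ⟨hx, uIoc_subset_uIcc hτ⟩)
    intervalIntegrable_const
    (Eventually.of_forall fun τ hτ x _ => ?_)
  have h1 := ((hH x τ (uIoc_subset_uIcc hτ)).differentiableAt (by simp)).hasFDerivAt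
  exact h1.comp_hasDerivAt x ((hasDerivAt_id x).prodMk (hasDerivAt_const x τ))

section Families

variable {E : Type*} [NormedAddCommGroup E] [NormedSpace ℝ E]
variable {B : Type*} [TopologicalSpace B] [ChartedSpace E B]
variable {P : Type*} [NormedAddCommGroup P] [NormedSpace ℝ P] {σ : P → Loop E B}

/-- The map `(p, t) ↦ σ(p)(t)`. -/
def evalFamily (σ : P → Loop E B) (m : P × ℝ) : B := σ m.1 m.2

theorem SmoothFamily.modelDeriv_comp (hσ : SmoothFamily σ) {N : Type*} [NormedAddCommGroup N]
    [NormedSpace ℝ N] {φ : N → P × ℝ} {φ' : N →L[ℝ] P × ℝ} {q : N} (hφ : HasFDerivAt φ φ' q) :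
    (modelDeriv (fun q => evalFamily σ (φ q)) q : N →L[ℝ] E) =
      (modelDeriv (evalFamily σ) (φ q) : P × ℝ →L[ℝ] E).comp φ' := by
  have h : MDifferentiableAt 𝓘(ℝ, P × ℝ) 𝓘(ℝ, E) (evalFamily σ) (φ q) :=
    hσ.mdifferentiableAt (by simp)
  rw [GerbeTransgression.modelDeriv_comp h hφ.differentiableAt, hφ.fderiv]

theorem SmoothFamily.velocity_eq (hσ : SmoothFamily σ) (p : P) (τ : ℝ) :
    velocity E (σ p) τ = modelDeriv (E := E) (evalFamily σ) (p, τ) (0, 1) := by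
  have h := hσ.modelDeriv_comp (φ := fun τ => (p, τ)) (q := τ)
    ((hasFDerivAt_const p τ).prodMk (hasFDerivAt_id τ))
  exact congrArg (fun l : ℝ →L[ℝ] E => l 1) h

theorem SmoothFamily.pderiv_eq (hσ : SmoothFamily σ) (p e : P) (τ : ℝ) :
    pderiv σ p e τ = modelDeriv (E := E) (evalFamily σ) (p, τ) (e, 0) := by
  have h := hσ.modelDeriv_comp (φ := fun p => (p, τ)) (q := p)
    ((hasFDerivAt_id p).prodMk (hasFDerivAt_const τ p))
  exact congrArg (fun l : P →L[ℝ] E => l e) h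

theorem SmoothFamily.contMDiff_eval (hσ : SmoothFamily σ) (τ : ℝ) :
    ContMDiff 𝓘(ℝ, P) 𝓘(ℝ, E) ∞ (fun p => σ p τ) :=
  ContMDiff.comp (g := fun m : P × ℝ => σ m.1 m.2) hσ
    (contDiff_prodMk_left (𝕜 := ℝ) (n := ∞) τ).contMDiff

theorem SmoothFamily.comp (hσ : SmoothFamily σ) {ρ : ℝ → P} (hρ : ContDiff ℝ ∞ ρ) :
    SmoothFamily (fun x => σ (ρ x)) :=
  ContMDiff.comp (g := fun m : P × ℝ => σ m.1 m.2) hσ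
    ((hρ.comp contDiff_fst).prodMk contDiff_snd).contMDiff

end Families

namespace LoopLineBundle

variable {E : Type*} [NormedAddCommGroup E] [NormedSpace ℝ E]
variable {B : Type*} [TopologicalSpace B] [ChartedSpace E B] (P : LoopLineBundle E B)

/-- Covariant derivatives are unique, since linear functionals separate points. -/
theorem HasCovDerivAt.unique {j : P.Idx} {Γ : ℝ → Loop E B} {v : ∀ x, P.Fibre j (Γ x)} {x₀ : ℝ}
    {w w' : P.Fibre j (Γ x₀)} (h : P.HasCovDerivAt j Γ v x₀ w) (h' : P.HasCovDerivAt j Γ v x₀ w') :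
    w = w' := by
  rw [← sub_eq_zero, ← Module.forall_dual_apply_eq_zero_iff ℂ]
  intro l
  rw [map_sub, (h l).unique (h' l), sub_self]

end LoopLineBundle

namespace GerbeWithConnection

variable {E : Type uE} [NormedAddCommGroup E] [NormedSpace ℝ E]
variable {B : Type uB} [TopologicalSpace B] [ChartedSpace E B]
variable {P : Type*} [NormedAddCommGroup P] [NormedSpace ℝ P]
variable (G : GerbeWithConnection.{uE, uB, uF, uK, uI} E B) {c : LoopChart G.Idx}

/-- A choice of one local frame of `L_{s(i-1) s(i)}` for every `i`. -/
abbrev Frames (c : LoopChart G.Idx) : Type _ :=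
  ∀ i : Fin c.n, (G.L (c.s (((i : ℕ) : ℤ) - 1)) (c.s ((i : ℕ) : ℤ))).FrameIdx

variable {G}

/-- The section `⊗ᵢ frame(kᵢ)(γ(t(i)))` of the transgressed bundle. -/
def frameTensor (k : G.Frames c) (γ : Loop E B) : G.loopFibre c γ :=
  PiTensorProduct.tprod ℂ fun i : Fin c.n => (G.L _ _).frame (k i) (γ (c.t ((i : ℕ) : ℤ)))

/-- The frames `k` are defined at `γ`. -/
def FramesAt (k : G.Frames c) (γ : Loop E B) : Prop :=
  ∀ i : Fin c.n, γ (c.t ((i : ℕ) : ℤ)) ∈ (G.L _ _).dom (k i)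

variable (G) in
/-- The form `β(e) = ∑ᵢ ∫_{[t(i), t(i+1)]} F_{s(i)}(∂_t, e) dt` at the point `p` of a family. -/
def curvingForm (c : LoopChart G.Idx) (σ : P → Loop E B) (p e : P) : ℝ :=
  ∑ i : Fin c.n, ∫ τ in (c.t ((i : ℕ) : ℤ))..(c.t (((i : ℕ) : ℤ) + 1)),
    (G.F (c.s ((i : ℕ) : ℤ))).pull (evalFamily σ) (p, τ) ![(0, 1), (e, 0)]

/-- The connection form of the transgressed bundle with respect to the section `frameTensor k`:
the sum of the connection forms at the points `t(i)`, minus `2πi` times `curvingForm`. -/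
def connectionForm (k : G.Frames c) (σ : P → Loop E B) (p e : P) : ℂ :=
  ∑ i : Fin c.n, ((G.L _ _).A (k i)).pull (fun q => σ q (c.t ((i : ℕ) : ℤ))) p ![e] -
    2 * Real.pi * Complex.I * G.curvingForm c σ p e

theorem curvingForm_comp {σ : P → Loop E B} (hσ : SmoothFamily σ) {ρ : ℝ → P}
    (hρ : ContDiff ℝ ∞ ρ) (x : ℝ) :
    G.curvingForm c (fun x => σ (ρ x)) x 1 = G.curvingForm c σ (ρ x) (deriv ρ x) := by
  unfold curvingForm
  congr! 3 with i _ τ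
  have hd : HasFDerivAt (fun m : ℝ × ℝ => (ρ m.1, m.2))
      (((ContinuousLinearMap.toSpanSingleton ℝ (deriv ρ x)).comp
        (ContinuousLinearMap.fst ℝ ℝ ℝ)).prod (ContinuousLinearMap.snd ℝ ℝ ℝ)) (x, τ) := by
    refine HasFDerivAt.prodMk ?_ hasFDerivAt_snd
    exact ((hρ.differentiable (by simp)).differentiableAt.hasDerivAt.hasFDerivAt).comp
      (x, τ) (hasFDerivAt_fst (p := (x, τ)))
  have h := hσ.modelDeriv_comp hd
  rw [Form.pull_apply_two, Form.pull_apply_two]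
  have h1 : (modelDeriv (evalFamily fun x => σ (ρ x)) (x, τ) : ℝ × ℝ →L[ℝ] E) = _ := h
  rw [h1]
  simp only [ContinuousLinearMap.comp_apply, ContinuousLinearMap.prod_apply,
    ContinuousLinearMap.toSpanSingleton_apply, ContinuousLinearMap.coe_fst',
    ContinuousLinearMap.coe_snd', zero_smul, one_smul]
  rfl

theorem mem_U_of_mem_loopDom {γ : Loop E B} (hγ : γ ∈ G.loopDom c) (i : ℤ) {τ : ℝ}
    (hτ : τ ∈ uIcc (c.t i) (c.t (i + 1))) : γ τ ∈ G.U (c.s i) := by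
  rw [uIcc_of_le (c.mono (by simp))] at hτ
  exact (hγ i τ hτ).2

theorem mem_inter_of_mem_loopDom {γ : Loop E B} (hγ : γ ∈ G.loopDom c) (i : ℤ) :
    γ (c.t i) ∈ G.U (c.s (i - 1)) ∩ G.U (c.s i) :=
  hγ i _ ⟨le_rfl, c.mono (by simp)⟩

theorem exists_framesAt {γ : Loop E B} (hγ : γ ∈ G.loopDom c) :
    ∃ k : G.Frames c, FramesAt k γ := by
  choose k hk using fun i : Fin c.n =>
    (G.L _ _).exists_mem_dom _ (mem_inter_of_mem_loopDom hγ ((i : ℕ) : ℤ))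
  exact ⟨k, hk⟩

theorem FramesAt.eventually {k : G.Frames c} {σ : P → Loop E B} (hσ : SmoothFamily σ) {p : P}
    (hk : FramesAt k (σ p)) : ∀ᶠ q in 𝓝 p, FramesAt k (σ q) :=
  eventually_all.2 fun i => (hσ.contMDiff_eval _).continuous.continuousAt.preimage_mem_nhds
    (((G.L _ _).isOpen_dom (k i)).mem_nhds (hk i))

variable [IsManifold 𝓘(ℝ, E) ∞ B]

theorem contDiffAt_pull_F {σ : P → Loop E B} (hσ : SmoothFamily σ) {p : P} (hp : σ p ∈ G.loopDom c)
    (i : ℤ) {τ : ℝ} (hτ : τ ∈ uIcc (c.t i) (c.t (i + 1))) (v : Fin 2 → P × ℝ) :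
    ContDiffAt ℝ ∞ (fun m => (G.F (c.s i)).pull (evalFamily σ) m v) (p, τ) :=
  Form.contDiffAt_pull_apply (G.smooth_F _) (G.isOpen_U _) isOpen_univ
    (ContMDiff.contMDiffOn hσ) (mem_univ _) (mem_U_of_mem_loopDom hp i hτ) v

theorem continuous_curvingForm {Γ : ℝ → Loop E B} (hΓ : SmoothFamily Γ)
    (hdom : ∀ x, Γ x ∈ G.loopDom c) : Continuous fun x => G.curvingForm c Γ x 1 :=
  continuous_finsetSum _ fun i _ => continuous_iff_continuousAt.2 fun x =>
    (hasDerivAt_integral_of_contDiffAt (H := fun m =>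
      (G.F (c.s ((i : ℕ) : ℤ))).pull (evalFamily Γ) m ![(0, 1), (1, 0)])
      (fun x _ hτ => contDiffAt_pull_F hΓ (hdom x) ((i : ℕ) : ℤ) hτ _) x).2.continuousAt

theorem loopFactor_eq {Γ : ℝ → Loop E B} (hΓ : SmoothFamily Γ)
    (hdom : ∀ x, Γ x ∈ G.loopDom c) (a b : ℝ) :
    G.loopFactor c Γ a b =
      Complex.exp (2 * Real.pi * Complex.I * ((∫ x in a..b, G.curvingForm c Γ x 1 : ℝ) : ℂ)) := by
  unfold loopFactor curvingForm
  rw [intervalIntegral.integral_finsetSum, ← Complex.exp_sum, Complex.ofReal_sum, Finset.mul_sum]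
  · congr! 7 with i _ x
    funext τ
    rw [Form.pull_apply_two, hΓ.velocity_eq, hΓ.pderiv_eq]
    rfl
  · intro i _
    refine Continuous.intervalIntegrable (continuous_iff_continuousAt.2 fun x => ?_) a b
    exact (hasDerivAt_integral_of_contDiffAt (H := fun m =>
      (G.F (c.s ((i : ℕ) : ℤ))).pull (evalFamily Γ) m ![(0, 1), (1, 0)])
      (fun x τ hτ => contDiffAt_pull_F hΓ (hdom x) ((i : ℕ) : ℤ) hτ _) x).2.continuousAt

theorem transport_frameTensor {Γ : ℝ → Loop E B} (hΓ : SmoothFamily Γ) {k : G.Frames c} {a b : ℝ}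
    (hk : ∀ x ∈ uIcc a b, FramesAt k (Γ x)) :
    G.transgression.transport c Γ a b (frameTensor k (Γ a)) =
      (G.loopFactor c Γ a b * Complex.exp (-∑ i : Fin c.n, ∫ x in a..b,
        (G.L _ _).pathForm (k i) (fun x => Γ x (c.t ((i : ℕ) : ℤ))) x)) •
          frameTensor k (Γ b) := by
  change G.loopFactor c Γ a b • PiTensorProduct.map _ (frameTensor k (Γ a)) = _
  unfold frameTensor
  rw [PiTensorProduct.map_tprod, mul_smul, ← Finset.sum_neg_distrib, Complex.exp_sum,
    ← MultilinearMap.map_smul_univ]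
  congr! 3 with i
  exact (G.L _ _).transport_frame (hΓ.contMDiff_eval _) fun x hx => hk x hx i

/-- The covariant derivative of the section `f • frameTensor k` along a path is
`(f' + f · connectionForm) • frameTensor k`. -/
theorem hasCovDerivAt_frameTensor {σ : P → Loop E B} (hσ : SmoothFamily σ)
    (hdom : ∀ p, σ p ∈ G.loopDom c) {ρ : ℝ → P} (hρ : ContDiff ℝ ∞ ρ) {x₀ : ℝ} {k : G.Frames c}
    (hk : FramesAt k (σ (ρ x₀))) {f : ℝ → ℂ} {f' : ℂ} (hf : HasDerivAt f f' x₀)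
    {v : ∀ x, G.loopFibre c (σ (ρ x))}
    (hv : ∀ᶠ x in 𝓝 x₀, v x = f x • frameTensor k (σ (ρ x))) :
    G.transgression.HasCovDerivAt c (fun x => σ (ρ x)) v x₀
      ((f' + f x₀ * connectionForm k σ (ρ x₀) (deriv ρ x₀)) • frameTensor k (σ (ρ x₀))) := by
  set Γ : ℝ → Loop E B := fun x => σ (ρ x) with hΓdef
  have hΓ : SmoothFamily Γ := hσ.comp hρ
  have hΓdom : ∀ x, Γ x ∈ G.loopDom c := fun x => hdom _
  set α : Fin c.n → ℝ → ℂ := fun i x =>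
    (G.L _ _).pathForm (k i) (fun x => Γ x (c.t ((i : ℕ) : ℤ))) x with hα
  -- parallel transport from `Γ x` to `Γ x₀` multiplies `frameTensor k` by `exp (h x)`
  set h : ℝ → ℂ := fun x =>
    2 * Real.pi * Complex.I * ((∫ x' in x..x₀, G.curvingForm c Γ x' 1 : ℝ) : ℂ) -
      ∑ i, ∫ x' in x..x₀, α i x' with hh
  have hαc : ∀ i, HasDerivAt (fun x => ∫ x' in x..x₀, α i x') (-α i x₀) x₀ := by
    intro i
    have h1 : HasDerivAt (fun x => ∫ x' in x₀..x, α i x') (α i x₀) x₀ :=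
      hasDerivAt_integral_of_continuousOn
        (((G.L _ _).isOpen_dom (k i)).preimage (hΓ.contMDiff_eval _).continuous)
        ((G.L _ _).continuousOn_pathForm (k i) (hΓ.contMDiff_eval _)) (by
          rw [uIcc_self, singleton_subset_iff]; exact hk i)
    simpa only [← intervalIntegral.integral_symm] using h1.fun_neg
  have hβc : HasDerivAt (fun x => ∫ x' in x..x₀, G.curvingForm c Γ x' 1)
      (-G.curvingForm c Γ x₀ 1) x₀ := by
    have h1 : HasDerivAt (fun x => ∫ x' in x₀..x, G.curvingForm c Γ x' 1)
        (G.curvingForm c Γ x₀ 1) x₀ :=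
      hasDerivAt_integral_of_continuousOn isOpen_univ
        (continuous_curvingForm hΓ hΓdom).continuousOn (subset_univ _)
    simpa only [← intervalIntegral.integral_symm] using h1.fun_neg
  have hconn : connectionForm k σ (ρ x₀) (deriv ρ x₀) =
      ∑ i, α i x₀ - 2 * Real.pi * Complex.I * (G.curvingForm c Γ x₀ 1 : ℝ) := by
    unfold connectionForm
    rw [hΓdef, curvingForm_comp hσ hρ]
    congr 1
    refine Finset.sum_congr rfl fun i _ => ?_
    rw [hα]
    dsimp only
    rw [HermLineBundle.pathForm_eq_pull, hΓdef,
      Form.pull_comp _ ((hσ.contMDiff_eval _).mdifferentiableAt (by simp))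
        ((hρ.differentiable (by simp)) x₀)]
    refine congrArg (((G.L _ _).A (k i)).pull (fun q => σ q (c.t ((i : ℕ) : ℤ))) (ρ x₀)) ?_
    ext j
    fin_cases j
    exact fderiv_apply_one_eq_deriv.symm
  have hhd : HasDerivAt h (connectionForm k σ (ρ x₀) (deriv ρ x₀)) x₀ := by
    rw [hconn]
    have h1 := (hβc.ofReal_comp.const_mul (2 * Real.pi * Complex.I)).sub
      (HasDerivAt.fun_sum (u := Finset.univ) fun i _ => hαc i)
    refine h1.congr_deriv ?_
    rw [Finset.sum_neg_distrib]
    push_cast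
    ring
  have hh0 : h x₀ = 0 := by simp [hh]
  intro (l : Module.Dual ℂ (G.loopFibre c (Γ x₀)))
  have hder : HasDerivAt (fun x => f x * Complex.exp (h x) * l (frameTensor k (Γ x₀)))
      (l ((f' + f x₀ * connectionForm k σ (ρ x₀) (deriv ρ x₀)) • frameTensor k (Γ x₀))) x₀ := by
    have h1 := (hf.mul hhd.cexp).mul_const (l (frameTensor k (Γ x₀)))
    refine h1.congr_deriv ?_
    rw [hh0, Complex.exp_zero, map_smul, smul_eq_mul]
    ring
  refine hder.congr_of_eventuallyEq ?_
  have hkΓ : ∀ᶠ x in 𝓝 x₀, FramesAt k (Γ x) := FramesAt.eventually hΓ hk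
  -- the transport is only known where the frames are defined, so `x` has to be close to `x₀`
  obtain ⟨ε, hε, hball⟩ := Metric.eventually_nhds_iff_ball.1 hkΓ
  filter_upwards [hv, Metric.ball_mem_nhds x₀ hε] with x hx hxε
  have hseg : ∀ x' ∈ uIcc x x₀, FramesAt k (Γ x') := fun x' hx' =>
    hball x' ((convex_ball x₀ ε).ordConnected.uIcc_subset hxε (Metric.mem_ball_self hε) hx')
  let T : G.loopFibre c (Γ x) →ₗ[ℂ] G.loopFibre c (Γ x₀) := G.transgression.transport c Γ x x₀
  have hT : T (frameTensor k (Γ x)) = _ := transport_frameTensor hΓ hseg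
  change l (T (v x)) = _
  rw [hx, map_smul, hT, loopFactor_eq hΓ hΓdom, ← Complex.exp_add,
    ← sub_eq_add_neg, map_smul, map_smul, smul_eq_mul, smul_eq_mul]
  exact (mul_assoc _ _ _).symm

end GerbeWithConnection

/-! ### The covering of the loop space and the derivatives of the connection form -/

section ExteriorDerivative

variable {M F : Type*} [NormedAddCommGroup M] [NormedSpace ℝ M] [NormedAddCommGroup F]
  [NormedSpace ℝ F]

theorem extDeriv_one_apply {κ : M → M [⋀^Fin 1]→L[ℝ] F} {m : M} (h : DifferentiableAt ℝ κ m)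
    (v w : M) : extDeriv κ m ![v, w] =
      fderiv ℝ (fun m => κ m ![w]) m v - fderiv ℝ (fun m => κ m ![v]) m w := by
  have h0 : Fin.removeNth 0 ![v, w] = ![w] := by ext j; fin_cases j; rfl
  have h1 : Fin.removeNth 1 ![v, w] = ![v] := by ext j; fin_cases j; rfl
  rw [extDeriv_apply h, Fin.sum_univ_two, h0, h1]
  simp [sub_eq_add_neg]

theorem extDeriv_two_apply {κ : M → M [⋀^Fin 2]→L[ℝ] F} {m : M} (h : DifferentiableAt ℝ κ m)
    (u v w : M) : extDeriv κ m ![u, v, w] =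
      fderiv ℝ (fun m => κ m ![v, w]) m u - fderiv ℝ (fun m => κ m ![u, w]) m v +
        fderiv ℝ (fun m => κ m ![u, v]) m w := by
  have h0 : Fin.removeNth 0 ![u, v, w] = ![v, w] := by ext j; fin_cases j <;> rfl
  have h1 : Fin.removeNth 1 ![u, v, w] = ![u, w] := by ext j; fin_cases j <;> rfl
  have h2 : Fin.removeNth 2 ![u, v, w] = ![u, v] := by ext j; fin_cases j <;> rfl
  rw [extDeriv_apply h, Fin.sum_univ_three, h0, h1, h2]
  simp [sub_eq_add_neg]

end ExteriorDerivative

section Families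

variable {E : Type*} [NormedAddCommGroup E] [NormedSpace ℝ E]
variable {B : Type*} [TopologicalSpace B] [ChartedSpace E B]
variable {P : Type*} [NormedAddCommGroup P] [NormedSpace ℝ P] {σ : P → Loop E B}
variable {F : Type*} [NormedAddCommGroup F] [NormedSpace ℝ F] {n : ℕ}

theorem Form.pull_evalFamily_add_one (η : Form E B F n) (hσ : SmoothFamily σ) (p : P) (τ : ℝ) :
    η.pull (evalFamily σ) (p, τ + 1) = η.pull (evalFamily σ) (p, τ) := by
  have hd : HasFDerivAt (fun m : P × ℝ => m + (0, 1)) (ContinuousLinearMap.id ℝ (P × ℝ)) (p, τ) :=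
    (hasFDerivAt_id _).add_const _
  have h := η.pull_comp (Φ := evalFamily σ) (φ := fun m : P × ℝ => m + (0, 1)) (q := (p, τ))
    (ContMDiff.mdifferentiableAt hσ (by simp)) hd.differentiableAt
  have hper : (fun m : P × ℝ => evalFamily σ (m + (0, 1))) = evalFamily σ := by
    funext m
    exact (congrArg (fun p => σ p (m.2 + 1)) (add_zero m.1)).trans ((σ m.1).periodic m.2)
  rw [hper, hd.fderiv, Prod.mk_add_mk, add_zero] at h
  exact h.symm

theorem Form.pull_eval (η : Form E B F n) (hσ : SmoothFamily σ) (p : P) (τ : ℝ) (v : Fin n → P) :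
    η.pull (fun p => σ p τ) p v = η.pull (evalFamily σ) (p, τ) (fun j => (v j, 0)) := by
  have hd : HasFDerivAt (fun p : P => (p, τ)) _ p :=
    (hasFDerivAt_id (𝕜 := ℝ) p).prodMk (hasFDerivAt_const τ p)
  have h := η.pull_comp (Φ := evalFamily σ) (φ := fun p : P => (p, τ)) (q := p)
    (ContMDiff.mdifferentiableAt hσ (by simp)) hd.differentiableAt
  rw [hd.fderiv] at h
  exact congrArg (fun κ => κ v) h

end Families

/-- Every loop has a subdivision `i / n` of the circle, together with members `W (s i)` of a given
open covering, such that `γ([i / n, (i + 2) / n]) ⊆ W (s i)`. -/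
theorem exists_subdivision {B I : Type*} [TopologicalSpace B] {W : I → Set B}
    (hW : ∀ α, IsOpen (W α)) (hcov : ∀ x, ∃ α, x ∈ W α) {γ : ℝ → B} (hγ : Continuous γ)
    (hper : Function.Periodic γ 1) :
    ∃ n : ℕ, 0 < n ∧ ∃ s : ℤ → I, (∀ i, s (i + n) = s i) ∧
      ∀ (i : ℤ) (τ : ℝ), (i : ℝ) / n ≤ τ → τ ≤ (i + 2) / n → γ τ ∈ W (s i) := by
  obtain ⟨δ, hδ, hleb⟩ := lebesgue_number_lemma_of_metric (isCompact_Icc (a := (0 : ℝ)) (b := 1))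
    (fun α => (hW α).preimage hγ)
    (fun τ _ => mem_iUnion.2 (hcov (γ τ)))
  obtain ⟨n, hn⟩ := exists_nat_gt (2 / δ)
  have hn0 : (0 : ℝ) < n := (div_pos two_pos hδ).trans hn
  have hnN : 0 < n := by exact_mod_cast hn0
  have hnZ : (0 : ℤ) < n := by exact_mod_cast hnN
  have hn2 : 2 / (n : ℝ) < δ := by rwa [div_lt_iff₀ hn0, mul_comm, ← div_lt_iff₀ hδ]
  have hmem : ∀ i : ℤ, ((i % n : ℤ) : ℝ) / n ∈ Icc (0 : ℝ) 1 := fun i => by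
    have h1 : (0 : ℝ) ≤ ((i % n : ℤ) : ℝ) := by exact_mod_cast Int.emod_nonneg i hnZ.ne'
    have h2 : ((i % n : ℤ) : ℝ) ≤ n := by exact_mod_cast (Int.emod_lt_of_pos i hnZ).le
    exact ⟨div_nonneg h1 hn0.le, (div_le_one hn0).2 h2⟩
  choose f hf using fun τ : Icc (0 : ℝ) 1 => hleb τ τ.2
  -- `s i` is chosen at the representative `(i mod n) / n` of `i / n` in `[0, 1]`
  refine ⟨n, hnN, fun i => f ⟨_, hmem i⟩, fun i => ?_, fun i τ h1 h2 => ?_⟩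
  · have : (i + n) % (n : ℤ) = i % n := by simp
    simp only [this]
  · have hi : (i : ℝ) = n * ((i / n : ℤ) : ℝ) + ((i % n : ℤ) : ℝ) := by
      exact_mod_cast (Int.mul_ediv_add_emod i n).symm
    have hball : τ - ((i / n : ℤ) : ℝ) ∈ Metric.ball (((i % n : ℤ) : ℝ) / n) δ := by
      have h3 : (i : ℝ) / n = ((i / n : ℤ) : ℝ) + ((i % n : ℤ) : ℝ) / n := by
        rw [hi]
        field_simp
      rw [add_div] at h2
      rw [Metric.mem_ball, Real.dist_eq, abs_lt]
      constructor <;> linarith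
    have h := hf ⟨_, hmem i⟩ hball
    rw [mem_preimage] at h
    have hp := hper.sub_zsmul_eq (x := τ) (i / n : ℤ)
    rw [zsmul_eq_mul, mul_one] at hp
    rwa [hp] at h

namespace GerbeWithConnection

variable {E : Type uE} [NormedAddCommGroup E] [NormedSpace ℝ E]
variable {B : Type uB} [TopologicalSpace B] [ChartedSpace E B]
variable {P : Type*} [NormedAddCommGroup P] [NormedSpace ℝ P]
variable (G : GerbeWithConnection.{uE, uB, uF, uK, uI} E B)

theorem exists_mem_loopDom (γ : Loop E B) : ∃ c : LoopChart G.Idx, γ ∈ G.loopDom c := by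
  obtain ⟨n, hn, s, hs, h⟩ := exists_subdivision G.isOpen_U G.exists_mem_U γ.smooth.continuous
    γ.periodic
  have hn0 : (0 : ℝ) < n := by exact_mod_cast hn
  refine ⟨⟨n, fun i => i / n, s, fun i j hij => ?_, fun i => ?_, hs⟩, fun i τ hτ => ⟨?_, ?_⟩⟩
  · have : (i : ℝ) ≤ j := by exact_mod_cast hij
    dsimp only
    gcongr
  · push_cast
    field_simp
  · refine h _ τ (le_trans ?_ hτ.1) (hτ.2.trans ?_)
    · dsimp only
      gcongr
      simp
    · dsimp only
      gcongr
      push_cast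
      linarith
  · refine h _ τ hτ.1 (hτ.2.trans ?_)
    dsimp only
    gcongr
    push_cast
    linarith

variable {G} {c : LoopChart G.Idx}
variable [IsManifold 𝓘(ℝ, E) ∞ B]

theorem contDiffAt_pull_A {k : G.Frames c} {σ : P → Loop E B} (hσ : SmoothFamily σ) {p : P}
    (hk : FramesAt k (σ p)) (i : Fin c.n) (v : Fin 1 → P) :
    ContDiffAt ℝ ∞ (fun q => ((G.L _ _).A (k i)).pull (fun q => σ q (c.t ((i : ℕ) : ℤ))) q v) p :=
  Form.contDiffAt_pull_apply ((G.L _ _).smooth_A (k i)) ((G.L _ _).isOpen_dom (k i)) isOpen_univ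
    (hσ.contMDiff_eval _).contMDiffOn (mem_univ p) (hk i) v

/-- The summands of `curvingForm` may be differentiated under the integral sign. -/
theorem hasDerivAt_integral_pull_F {σ : P → Loop E B} (hσ : SmoothFamily σ)
    (hdom : ∀ p, σ p ∈ G.loopDom c) {ρ : ℝ → P} (hρ : ContDiff ℝ ∞ ρ) (x₀ : ℝ) (i : ℤ)
    (v : Fin 2 → P × ℝ) :
    IntervalIntegrable (fun τ => fderiv ℝ (fun m => (G.F (c.s i)).pull (evalFamily σ) m v)
      (ρ x₀, τ) (deriv ρ x₀, 0)) MeasureTheory.volume (c.t i) (c.t (i + 1)) ∧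
    HasDerivAt (fun x => ∫ τ in (c.t i)..(c.t (i + 1)),
        (G.F (c.s i)).pull (evalFamily σ) (ρ x, τ) v)
      (∫ τ in (c.t i)..(c.t (i + 1)), fderiv ℝ (fun m => (G.F (c.s i)).pull (evalFamily σ) m v)
        (ρ x₀, τ) (deriv ρ x₀, 0)) x₀ := by
  set H : P × ℝ → ℝ := fun m => (G.F (c.s i)).pull (evalFamily σ) m v with hHdef
  have hH : ∀ x, ∀ τ ∈ uIcc (c.t i) (c.t (i + 1)), ContDiffAt ℝ ∞ H (ρ x, τ) := fun x τ hτ =>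
    contDiffAt_pull_F hσ (hdom _) i hτ v
  have hρ2 : ContDiff ℝ ∞ (fun q : ℝ × ℝ => (ρ q.1, q.2)) :=
    (hρ.comp contDiff_fst).prodMk contDiff_snd
  have hHρ : ∀ x, ∀ τ ∈ uIcc (c.t i) (c.t (i + 1)),
      ContDiffAt ℝ ∞ (fun q : ℝ × ℝ => H (ρ q.1, q.2)) (x, τ) := fun x τ hτ =>
    ContDiffAt.comp (g := H) (f := fun q : ℝ × ℝ => (ρ q.1, q.2)) (x, τ) (hH x τ hτ)
      hρ2.contDiffAt
  have h := hasDerivAt_integral_of_contDiffAt (H := fun q : ℝ × ℝ => H (ρ q.1, q.2))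
    (a := c.t i) (b := c.t (i + 1)) hHρ x₀
  have hfd : EqOn (fun τ => fderiv ℝ (fun q : ℝ × ℝ => H (ρ q.1, q.2)) (x₀, τ) (1, 0))
      (fun τ => fderiv ℝ H (ρ x₀, τ) (deriv ρ x₀, 0)) (uIcc (c.t i) (c.t (i + 1))) := by
    intro τ hτ
    have h1 := ((hH x₀ τ hτ).differentiableAt (by simp)).hasFDerivAt.comp_hasDerivAt x₀
      ((hρ.differentiable (by simp) x₀).hasDerivAt.prodMk (hasDerivAt_const x₀ τ))
    have h2 := ((hHρ x₀ τ hτ).differentiableAt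
      (by simp)).hasFDerivAt.comp_hasDerivAt x₀
        ((hasDerivAt_id x₀).prodMk (hasDerivAt_const x₀ τ))
    exact h2.unique h1
  refine ⟨IntervalIntegrable.congr (hfd.mono uIoc_subset_uIcc) h.1, ?_⟩
  rw [← intervalIntegral.integral_congr hfd]
  exact h.2

theorem hasDerivAt_connectionForm {k : G.Frames c} {σ : P → Loop E B} (hσ : SmoothFamily σ)
    (hdom : ∀ p, σ p ∈ G.loopDom c) {ρ : ℝ → P} (hρ : ContDiff ℝ ∞ ρ) {x₀ : ℝ}
    (hk : FramesAt k (σ (ρ x₀))) (e : P) :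
    HasDerivAt (fun x => connectionForm k σ (ρ x) e)
      (∑ i : Fin c.n, fderiv ℝ (fun q => ((G.L _ _).A (k i)).pull
          (fun q => σ q (c.t ((i : ℕ) : ℤ))) q ![e]) (ρ x₀) (deriv ρ x₀) -
        2 * Real.pi * Complex.I * ((∑ i : Fin c.n,
          ∫ τ in (c.t ((i : ℕ) : ℤ))..(c.t (((i : ℕ) : ℤ) + 1)),
            fderiv ℝ (fun m => (G.F (c.s ((i : ℕ) : ℤ))).pull (evalFamily σ) m ![(0, 1), (e, 0)])
              (ρ x₀, τ) (deriv ρ x₀, 0) : ℝ) : ℂ)) x₀ := by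
  refine HasDerivAt.sub (HasDerivAt.fun_sum fun i _ => ?_)
    (HasDerivAt.const_mul _ (HasDerivAt.ofReal_comp (HasDerivAt.fun_sum fun i _ =>
      (hasDerivAt_integral_pull_F hσ hdom hρ x₀ ((i : ℕ) : ℤ) _).2)))
  exact ((contDiffAt_pull_A hσ hk i _).differentiableAt (by simp)).hasFDerivAt.comp_hasDerivAt x₀
    (hρ.differentiable (by simp) x₀).hasDerivAt

end GerbeWithConnection

/-! ### Stokes' theorem and the cancellation of the boundary terms -/

namespace GerbeWithConnection

variable {E : Type uE} [NormedAddCommGroup E] [NormedSpace ℝ E]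
variable {B : Type uB} [TopologicalSpace B] [ChartedSpace E B] [IsManifold 𝓘(ℝ, E) ∞ B]
variable {P : Type*} [NormedAddCommGroup P] [NormedSpace ℝ P]
variable {G : GerbeWithConnection.{uE, uB, uF, uK, uI} E B} {c : LoopChart G.Idx}

theorem extDeriv_pull_F {σ : P → Loop E B} (hσ : SmoothFamily σ) {p : P} (hp : σ p ∈ G.loopDom c)
    (i : ℤ) {τ : ℝ} (hτ : τ ∈ uIcc (c.t i) (c.t (i + 1))) :
    extDeriv ((G.F (c.s i)).pull (evalFamily σ)) (p, τ) =
      G.curvature.pull (evalFamily σ) (p, τ) := by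
  have hU := mem_U_of_mem_loopDom hp i hτ
  rw [Form.extDeriv_pull (Φ := evalFamily σ) (G.smooth_F _) (G.isOpen_U _) isOpen_univ
    (ContMDiff.contMDiffOn hσ) (mem_univ _) hU]
  unfold Form.pull
  rw [show G.curvature.onModel (evalFamily σ (p, τ)) = (G.F (c.s i)).d.onModel _ from
    G.curvature_eq hU]

variable {σ : P → Loop E B}

/-- Stokes' theorem on one interval of the subdivision: with `e₁`, `e₂` constant vector fields,
`dF(∂_t, e₁, e₂) = ∂_t F(e₁, e₂) - ∂_{e₁} F(∂_t, e₂) + ∂_{e₂} F(∂_t, e₁)`. -/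
theorem integral_curvature_interval (hσ : SmoothFamily σ) (hdom : ∀ p, σ p ∈ G.loopDom c)
    (p e₁ e₂ : P) (i : ℤ) :
    IntervalIntegrable (fun τ => G.curvature.pull (evalFamily σ) (p, τ)
      ![(0, 1), (e₁, 0), (e₂, 0)]) MeasureTheory.volume (c.t i) (c.t (i + 1)) ∧
    (∫ τ in (c.t i)..(c.t (i + 1)), fderiv ℝ (fun m =>
        (G.F (c.s i)).pull (evalFamily σ) m ![(0, 1), (e₂, 0)]) (p, τ) (e₁, 0)) -
      (∫ τ in (c.t i)..(c.t (i + 1)), fderiv ℝ (fun m =>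
        (G.F (c.s i)).pull (evalFamily σ) m ![(0, 1), (e₁, 0)]) (p, τ) (e₂, 0)) =
      (G.F (c.s i)).pull (evalFamily σ) (p, c.t (i + 1)) ![(e₁, 0), (e₂, 0)] -
      (G.F (c.s i)).pull (evalFamily σ) (p, c.t i) ![(e₁, 0), (e₂, 0)] -
      ∫ τ in (c.t i)..(c.t (i + 1)), G.curvature.pull (evalFamily σ) (p, τ)
        ![(0, 1), (e₁, 0), (e₂, 0)] := by
  set κ := (G.F (c.s i)).pull (evalFamily σ) with hκ
  have hsm : ∀ v : Fin 2 → P × ℝ, ∀ τ ∈ uIcc (c.t i) (c.t (i + 1)),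
      ContDiffAt ℝ ∞ (fun m => κ m v) (p, τ) := fun v τ hτ => contDiffAt_pull_F hσ (hdom p) i hτ v
  have hint : ∀ (v : Fin 2 → P × ℝ) (e : P × ℝ), IntervalIntegrable
      (fun τ => fderiv ℝ (fun m => κ m v) (p, τ) e) MeasureTheory.volume
      (c.t i) (c.t (i + 1)) := by
    intro v e
    refine ContinuousOn.intervalIntegrable fun τ hτ => ContinuousAt.continuousWithinAt ?_
    have h1 : ContinuousAt (fun m => fderiv ℝ (fun m => κ m v) m e) (p, τ) :=
      (((hsm v τ hτ).fderiv_right (m := 0) (by simp)).clm_apply contDiffAt_const).continuousAt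
    exact h1.comp (f := fun τ => (p, τ)) (Continuous.prodMk_right p).continuousAt
  have hR : EqOn (fun τ => fderiv ℝ (fun m => κ m ![(e₁, 0), (e₂, 0)]) (p, τ) (0, 1) -
        fderiv ℝ (fun m => κ m ![(0, 1), (e₂, 0)]) (p, τ) (e₁, 0) +
        fderiv ℝ (fun m => κ m ![(0, 1), (e₁, 0)]) (p, τ) (e₂, 0))
      (fun τ => G.curvature.pull (evalFamily σ) (p, τ) ![(0, 1), (e₁, 0), (e₂, 0)])
      (uIcc (c.t i) (c.t (i + 1))) := by
    intro τ hτ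
    have hd : DifferentiableAt ℝ κ (p, τ) :=
      Form.differentiableAt_pull (G.smooth_F _) (G.isOpen_U _) isOpen_univ
        (ContMDiff.contMDiffOn hσ) (mem_univ _) (mem_U_of_mem_loopDom (hdom p) i hτ)
    dsimp only
    rw [← extDeriv_pull_F hσ (hdom p) i hτ, extDeriv_two_apply hd]
  have hftc : ∫ τ in (c.t i)..(c.t (i + 1)),
      fderiv ℝ (fun m => κ m ![(e₁, 0), (e₂, 0)]) (p, τ) (0, 1) =
      κ (p, c.t (i + 1)) ![(e₁, 0), (e₂, 0)] - κ (p, c.t i) ![(e₁, 0), (e₂, 0)] := by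
    refine intervalIntegral.integral_eq_sub_of_hasDerivAt
      (f := fun τ => κ (p, τ) ![(e₁, 0), (e₂, 0)]) (fun τ hτ => ?_) (hint _ _)
    exact ((hsm _ τ hτ).differentiableAt (by simp)).hasFDerivAt.comp_hasDerivAt τ
      ((hasDerivAt_const τ p).prodMk (hasDerivAt_id τ))
  refine ⟨IntervalIntegrable.congr (hR.mono uIoc_subset_uIcc)
    (((hint _ _).sub (hint _ _)).add (hint _ _)), ?_⟩
  rw [← intervalIntegral.integral_congr hR,
    intervalIntegral.integral_add ((hint _ _).sub (hint _ _)) (hint _ _),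
    intervalIntegral.integral_sub (hint _ _) (hint _ _), hftc]
  ring

/-- The integrals over the intervals of the subdivision add up to the integral over the circle. -/
theorem sum_integral_curvature (hσ : SmoothFamily σ) (hdom : ∀ p, σ p ∈ G.loopDom c)
    (p e₁ e₂ : P) :
    ∑ i : Fin c.n, ∫ τ in (c.t ((i : ℕ) : ℤ))..(c.t (((i : ℕ) : ℤ) + 1)),
      G.curvature.pull (evalFamily σ) (p, τ) ![(0, 1), (e₁, 0), (e₂, 0)] =
    ∫ τ in (0 : ℝ)..1, G.curvature.pull (evalFamily σ) (p, τ) ![(0, 1), (e₁, 0), (e₂, 0)] := by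
  set r : ℝ → ℝ := fun τ => G.curvature.pull (evalFamily σ) (p, τ) ![(0, 1), (e₁, 0), (e₂, 0)]
  have hper : Function.Periodic r 1 := fun τ =>
    congrArg (fun κ => κ ![(0, 1), (e₁, 0), (e₂, 0)])
      (G.curvature.pull_evalFamily_add_one hσ p τ)
  rw [Fin.sum_univ_eq_sum_range
    (fun i : ℕ => ∫ τ in (c.t (i : ℤ))..(c.t ((i : ℤ) + 1)), r τ)]
  have h := intervalIntegral.sum_integral_adjacent_intervals (f := r)
    (μ := MeasureTheory.volume) (a := fun i : ℕ => c.t (i : ℤ)) (n := c.n) (fun i _ => by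
      have := (integral_curvature_interval hσ hdom p e₁ e₂ (i : ℤ)).1
      push_cast
      exact this)
  push_cast at h
  have hn := c.t_add 0
  rw [zero_add] at hn
  rw [h, hn, hper.intervalIntegral_add_eq (c.t 0) 0, zero_add]

omit [IsManifold 𝓘(ℝ, E) ∞ B] in
/-- The boundary terms at the points `t(i)`: after a shift of the index, the differences
`F_{s(i)} - F_{s(i-1)}` remain, which are the Chern forms of the line bundles `L_{s(i-1) s(i)}`. -/
theorem sum_boundary_terms (hσ : SmoothFamily σ) {p : P} {k : G.Frames c}
    (hk : FramesAt k (σ p)) (e₁ e₂ : P) :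
    ((∑ i : Fin c.n, ((G.F (c.s ((i : ℕ) : ℤ))).pull (evalFamily σ)
        (p, c.t (((i : ℕ) : ℤ) + 1)) ![(e₁, 0), (e₂, 0)] -
      (G.F (c.s ((i : ℕ) : ℤ))).pull (evalFamily σ)
        (p, c.t ((i : ℕ) : ℤ)) ![(e₁, 0), (e₂, 0)]) : ℝ) : ℂ) =
    1 / (2 * Real.pi * Complex.I) * ∑ i : Fin c.n, ((G.L _ _).curvature (k i)).pull
      (fun q => σ q (c.t ((i : ℕ) : ℤ))) p ![e₁, e₂] := by
  set u : ℤ → ℝ := fun i =>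
    (G.F (c.s (i - 1))).pull (evalFamily σ) (p, c.t i) ![(e₁, 0), (e₂, 0)] with hu
  have hshift : ∑ i : Fin c.n, (G.F (c.s ((i : ℕ) : ℤ))).pull (evalFamily σ)
        (p, c.t (((i : ℕ) : ℤ) + 1)) ![(e₁, 0), (e₂, 0)] = ∑ i : Fin c.n, u ((i : ℕ) : ℤ) := by
    have h1 : ∀ i : ℤ, (G.F (c.s i)).pull (evalFamily σ) (p, c.t (i + 1)) ![(e₁, 0), (e₂, 0)] =
        u (i + 1) := fun i => by simp only [hu, add_sub_cancel_right]
    simp only [h1]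
    rw [Fin.sum_univ_eq_sum_range (fun i : ℕ => u ((i : ℤ) + 1)),
      Fin.sum_univ_eq_sum_range (fun i : ℕ => u (i : ℤ)), ← sub_eq_zero, ← Finset.sum_sub_distrib]
    have h2 := Finset.sum_range_sub (fun i : ℕ => u (i : ℤ)) c.n
    push_cast at h2
    rw [h2, sub_eq_zero]
    have h3 : c.s (c.n - 1 : ℤ) = c.s (0 - 1) := by
      rw [← c.s_add (0 - 1)]
      congr 1
    have h4 : c.t c.n = c.t 0 + 1 := by rw [← c.t_add 0, zero_add]
    simp only [hu]
    rw [h3, h4, Form.pull_evalFamily_add_one _ hσ]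
  rw [Finset.sum_sub_distrib, hshift, ← Finset.sum_sub_distrib, Complex.ofReal_sum,
    Finset.mul_sum]
  refine Finset.sum_congr rfl fun i _ => ?_
  have hv : (fun j => ((![e₁, e₂] : Fin 2 → P) j, (0 : ℝ))) = ![(e₁, 0), (e₂, 0)] := by
    ext j : 1
    fin_cases j <;> rfl
  have h := G.pull_F_sub_F (k i) (Φ := evalFamily σ) (m := (p, c.t ((i : ℕ) : ℤ))) (hk i)
    ![(e₁, 0), (e₂, 0)]
  rw [Form.pull_eval _ hσ, hv, Complex.ofReal_sub]
  rw [neg_div, neg_mul] at h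
  linear_combination -h

/-- The exterior derivative of the connection form of the transgressed bundle: the curvatures of
the line bundles cancel against the boundary terms of the integrals of the curvings. -/
theorem curvature_connectionForm (hσ : SmoothFamily σ) (hdom : ∀ p, σ p ∈ G.loopDom c) {p : P}
    {k : G.Frames c} (hk : FramesAt k (σ p)) {ρ₁ ρ₂ : ℝ → P} (hρ₁ : ContDiff ℝ ∞ ρ₁)
    (hρ₂ : ContDiff ℝ ∞ ρ₂) {x₁ x₂ : ℝ} (hp₁ : ρ₁ x₁ = p) (hp₂ : ρ₂ x₂ = p) {e₁ e₂ : P}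
    (he₁ : deriv ρ₁ x₁ = e₁) (he₂ : deriv ρ₂ x₂ = e₂) :
    ∃ d₁₂ d₂₁ : ℂ, HasDerivAt (fun x => connectionForm k σ (ρ₁ x) e₂) d₁₂ x₁ ∧
      HasDerivAt (fun x => connectionForm k σ (ρ₂ x) e₁) d₂₁ x₂ ∧
      d₁₂ - d₂₁ = 2 * Real.pi * Complex.I * ((∫ τ in (0 : ℝ)..1,
        G.curvature.pull (evalFamily σ) (p, τ) ![(0, 1), (e₁, 0), (e₂, 0)] : ℝ) : ℂ) := by
  have h₁ := hasDerivAt_connectionForm hσ hdom hρ₁ (x₀ := x₁) (by rwa [hp₁]) e₂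
  have h₂ := hasDerivAt_connectionForm hσ hdom hρ₂ (x₀ := x₂) (by rwa [hp₂]) e₁
  rw [hp₁, he₁] at h₁
  rw [hp₂, he₂] at h₂
  refine ⟨_, _, h₁, h₂, ?_⟩
  have hA : ∀ i : Fin c.n, ((G.L _ _).curvature (k i)).pull
      (fun q => σ q (c.t ((i : ℕ) : ℤ))) p ![e₁, e₂] =
      fderiv ℝ (fun q => ((G.L _ _).A (k i)).pull
          (fun q => σ q (c.t ((i : ℕ) : ℤ))) q ![e₂]) p e₁ -
        fderiv ℝ (fun q => ((G.L _ _).A (k i)).pull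
          (fun q => σ q (c.t ((i : ℕ) : ℤ))) q ![e₁]) p e₂ := by
    intro i
    have hc := (hσ.contMDiff_eval (c.t ((i : ℕ) : ℤ))).contMDiffOn (s := univ)
    rw [← extDeriv_one_apply (Form.differentiableAt_pull ((G.L _ _).smooth_A (k i))
      ((G.L _ _).isOpen_dom (k i)) isOpen_univ hc (mem_univ p) (hk i)),
      Form.extDeriv_pull ((G.L _ _).smooth_A (k i))
      ((G.L _ _).isOpen_dom (k i)) isOpen_univ hc (mem_univ p) (hk i)]
    rfl
  have hint := Finset.sum_congr (rfl : (Finset.univ : Finset (Fin c.n)) = _) fun i _ =>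
    (integral_curvature_interval hσ hdom p e₁ e₂ ((i : ℕ) : ℤ)).2
  rw [Finset.sum_sub_distrib, Finset.sum_sub_distrib, sum_integral_curvature hσ hdom] at hint
  have hint' := congrArg (Complex.ofReal) hint
  rw [Complex.ofReal_sub, Complex.ofReal_sub, sum_boundary_terms hσ hk] at hint'
  simp only [hA] at hint'
  rw [Finset.sum_sub_distrib] at hint'
  have hpi : (2 * Real.pi * Complex.I : ℂ) ≠ 0 := Complex.two_pi_I_ne_zero
  have h1 : (2 * Real.pi * Complex.I : ℂ) * (1 / (2 * Real.pi * Complex.I)) = 1 :=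
    mul_one_div_cancel hpi
  linear_combination (-(2 * Real.pi * Complex.I : ℂ)) * hint' -
    (∑ i : Fin c.n, fderiv ℝ (fun q => ((G.L _ _).A (k i)).pull
          (fun q => σ q (c.t ((i : ℕ) : ℤ))) q ![e₂]) p e₁ -
      ∑ i : Fin c.n, fderiv ℝ (fun q => ((G.L _ _).A (k i)).pull
          (fun q => σ q (c.t ((i : ℕ) : ℤ))) q ![e₁]) p e₂) * h1

omit [IsManifold 𝓘(ℝ, E) ∞ B] in
theorem transgressForm_pderiv (η : Form E B ℝ 3) (hσ : SmoothFamily σ) (p e₁ e₂ : P) :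
    transgressForm η (σ p) ![pderiv σ p e₁, pderiv σ p e₂] = ((∫ τ in (0 : ℝ)..1,
      η.pull (evalFamily σ) (p, τ) ![(0, 1), (e₁, 0), (e₂, 0)] : ℝ) : ℂ) := by
  unfold transgressForm
  congr 2
  funext τ
  rw [Form.pull_apply_three, ← hσ.velocity_eq, ← hσ.pderiv_eq, ← hσ.pderiv_eq]
  refine congrArg (η.onModel (σ p τ)) ?_
  ext j : 1
  fin_cases j <;> rfl

end GerbeWithConnection

/-! ### The curvature of the transgressed bundle -/

theorem hasDerivAt_fderiv_apply {P V : Type*} [NormedAddCommGroup P] [NormedSpace ℝ P]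
    [NormedAddCommGroup V] [NormedSpace ℝ V] {f : P → V} {ρ : ℝ → P} {x : ℝ} {e' : P}
    (hf : DifferentiableAt ℝ (fderiv ℝ f) (ρ x)) (hρ : HasDerivAt ρ e' x) (e : P) :
    HasDerivAt (fun x => fderiv ℝ f (ρ x) e) (fderiv ℝ (fderiv ℝ f) (ρ x) e' e) x :=
  (ContinuousLinearMap.apply ℝ V e).hasFDerivAt.comp_hasDerivAt x
    (hf.hasFDerivAt.comp_hasDerivAt x hρ)

namespace GerbeWithConnection

variable {E : Type uE} [NormedAddCommGroup E] [NormedSpace ℝ E]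
variable {B : Type uB} [TopologicalSpace B] [ChartedSpace E B] [IsManifold 𝓘(ℝ, E) ∞ B]
variable {G : GerbeWithConnection.{uE, uB, uF, uK, uI} E B} {c : LoopChart G.Idx}

/-- In a local frame `v = f • frameTensor`, the second derivatives of `f` and the terms quadratic in
the connection form cancel in the commutator of the covariant derivatives, which leaves `f` times the
exterior derivative of the connection form. -/
theorem isCurvature_transgression (G : GerbeWithConnection.{uE, uB, uF, uK, uI} E B) :
    G.transgression.IsCurvature (fun γ X =>
      2 * Real.pi * Complex.I * transgressForm G.curvature γ X) := by
  refine ⟨G.exists_mem_loopDom, fun (c : LoopChart G.Idx) σ hσ hdom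
    (v : ∀ p, G.loopFibre c (σ p)) hv => ?_⟩
  have hdom' : ∀ p, σ p ∈ G.loopDom c := hdom
  have hx : ∀ y : ℝ, ContDiff ℝ ∞ (fun x : ℝ => (x, y)) := fun y => contDiff_prodMk_left y
  have hy : ∀ x : ℝ, ContDiff ℝ ∞ (fun y : ℝ => (x, y)) := fun x => contDiff_prodMk_right x
  have hdx : ∀ x y : ℝ, HasDerivAt (fun x : ℝ => (x, y)) ((1, 0) : ℝ × ℝ) x := fun x y =>
    (hasDerivAt_id x).prodMk (hasDerivAt_const x y)
  have hdy : ∀ x y : ℝ, HasDerivAt (fun y : ℝ => (x, y)) ((0, 1) : ℝ × ℝ) y := fun x y =>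
    (hasDerivAt_const y x).prodMk (hasDerivAt_id y)
  have hcx : ∀ x y : ℝ, Tendsto (fun x : ℝ => (x, y)) (𝓝 x) (𝓝 (x, y)) := fun x y =>
    (Continuous.prodMk_left y).continuousAt
  have hcy : ∀ x y : ℝ, Tendsto (fun y : ℝ => (x, y)) (𝓝 y) (𝓝 (x, y)) := fun x y =>
    (Continuous.prodMk_right x).continuousAt
  -- the first covariant derivatives in terms of a local frame
  have hfirst : ∀ (x y : ℝ) (k : G.Frames c) (f : ℝ × ℝ → ℂ), FramesAt k (σ (x, y)) →
      DifferentiableAt ℝ f (x, y) → (∀ᶠ q in 𝓝 (x, y), v q = f q • frameTensor k (σ q)) →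
      G.transgression.HasCovDerivAt c (fun x => σ (x, y)) (fun x => v (x, y)) x
        ((fderiv ℝ f (x, y) (1, 0) + f (x, y) * connectionForm k σ (x, y) (1, 0)) •
          frameTensor k (σ (x, y))) ∧
      G.transgression.HasCovDerivAt c (fun y => σ (x, y)) (fun y => v (x, y)) y
        ((fderiv ℝ f (x, y) (0, 1) + f (x, y) * connectionForm k σ (x, y) (0, 1)) •
          frameTensor k (σ (x, y))) := by
    intro x y k f hk hf hvf
    have h1 := hasCovDerivAt_frameTensor hσ hdom' (hx y) (x₀ := x) hk
      (f := fun x => f (x, y)) (v := fun x => v (x, y))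
      (hf.hasFDerivAt.comp_hasDerivAt x (hdx x y)) ((hcx x y).eventually hvf)
    have h2 := hasCovDerivAt_frameTensor hσ hdom' (hy x) (x₀ := y) hk
      (f := fun y => f (x, y)) (v := fun y => v (x, y))
      (hf.hasFDerivAt.comp_hasDerivAt y (hdy x y)) ((hcy x y).eventually hvf)
    rw [(hdx x y).deriv] at h1
    rw [(hdy x y).deriv] at h2
    exact ⟨h1, h2⟩
  have hlocal : ∀ x y : ℝ, ∃ (k : G.Frames c) (f : ℝ × ℝ → ℂ), FramesAt k (σ (x, y)) ∧
      ContDiffAt ℝ ∞ f (x, y) ∧ ∀ᶠ q in 𝓝 (x, y), v q = f q • frameTensor k (σ q) := by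
    intro x y
    obtain ⟨k, hk⟩ := exists_framesAt (hdom' (x, y))
    obtain ⟨f, hf, hvf⟩ := hv (x, y) k hk
    exact ⟨k, f, hk, hf, hvf⟩
  have hexists : ∀ q : ℝ × ℝ, ∃ w₁ w₂ : G.loopFibre c (σ q),
      G.transgression.HasCovDerivAt c (fun x => σ (x, q.2)) (fun x => v (x, q.2)) q.1 w₁ ∧
      G.transgression.HasCovDerivAt c (fun y => σ (q.1, y)) (fun y => v (q.1, y)) q.2 w₂ := by
    intro q
    obtain ⟨k, f, hk, hf, hvf⟩ := hlocal q.1 q.2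
    exact ⟨_, _, hfirst q.1 q.2 k f hk (hf.differentiableAt (by simp)) hvf⟩
  choose v₁ v₂ hv₁ hv₂ using hexists
  have hsecond : ∀ q : ℝ × ℝ, ∃ w₁₂ w₂₁ : G.loopFibre c (σ q),
      G.transgression.HasCovDerivAt c (fun x => σ (x, q.2)) (fun x => v₂ (x, q.2)) q.1 w₁₂ ∧
      G.transgression.HasCovDerivAt c (fun y => σ (q.1, y)) (fun y => v₁ (q.1, y)) q.2 w₂₁ ∧
      w₁₂ - w₂₁ = (2 * Real.pi * Complex.I * transgressForm G.curvature (σ q)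
        ![pderiv σ q (1, 0), pderiv σ q (0, 1)]) • v q := by
    rintro ⟨x, y⟩
    obtain ⟨k, f, hk, hf, hvf⟩ := hlocal x y
    have hfd : ∀ᶠ q in 𝓝 (x, y), DifferentiableAt ℝ f q :=
      ((hf.of_le (m := 1) (by norm_cast)).eventually (by simp)).mono
        fun q hq => hq.differentiableAt (by simp)
    -- `v₁` and `v₂` are chosen pointwise, but by uniqueness one formula describes them near `(x, y)`
    have hnear : ∀ᶠ q in 𝓝 (x, y),
        v₁ q = (fderiv ℝ f q (1, 0) + f q * connectionForm k σ q (1, 0)) •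
          frameTensor k (σ q) ∧
        v₂ q = (fderiv ℝ f q (0, 1) + f q * connectionForm k σ q (0, 1)) •
          frameTensor k (σ q) := by
      filter_upwards [hfd, FramesAt.eventually hσ hk, hvf.eventually_nhds] with q hq hkq hvq
      have h := hfirst q.1 q.2 k f hkq hq hvq
      exact ⟨(hv₁ q).unique _ h.1, (hv₂ q).unique _ h.2⟩
    obtain ⟨d₁₂, d₂₁, hd₁₂, hd₂₁, hd⟩ := curvature_connectionForm hσ hdom' hk (hx y) (hy x)
      (rfl : (x, y) = (x, y)) (rfl : (x, y) = (x, y)) (hdx x y).deriv (hdy x y).deriv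
    have hf' : DifferentiableAt ℝ (fderiv ℝ f) (x, y) :=
      (hf.fderiv_right (m := 1) (by norm_cast)).differentiableAt (by simp)
    have hf₀ := (hf.differentiableAt (by simp)).hasFDerivAt
    have hsymm : fderiv ℝ (fderiv ℝ f) (x, y) (1, 0) (0, 1) =
        fderiv ℝ (fderiv ℝ f) (x, y) (0, 1) (1, 0) :=
      (hf.isSymmSndFDerivAt (by simp; norm_cast)) (1, 0) (0, 1)
    have hg₁ : HasDerivAt
        (fun x => fderiv ℝ f (x, y) (0, 1) + f (x, y) * connectionForm k σ (x, y) (0, 1))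
        (fderiv ℝ (fderiv ℝ f) (x, y) (1, 0) (0, 1) + (fderiv ℝ f (x, y) (1, 0) *
          connectionForm k σ (x, y) (0, 1) + f (x, y) * d₁₂)) x :=
      (hasDerivAt_fderiv_apply (ρ := fun x => (x, y)) hf' (hdx x y) (0, 1)).fun_add
        (HasDerivAt.fun_mul (hf₀.comp_hasDerivAt x (hdx x y)) hd₁₂)
    have hg₂ : HasDerivAt
        (fun y => fderiv ℝ f (x, y) (1, 0) + f (x, y) * connectionForm k σ (x, y) (1, 0))
        (fderiv ℝ (fderiv ℝ f) (x, y) (0, 1) (1, 0) + (fderiv ℝ f (x, y) (0, 1) *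
          connectionForm k σ (x, y) (1, 0) + f (x, y) * d₂₁)) y :=
      (hasDerivAt_fderiv_apply (ρ := fun y => (x, y)) hf' (hdy x y) (1, 0)).fun_add
        (HasDerivAt.fun_mul (hf₀.comp_hasDerivAt y (hdy x y)) hd₂₁)
    have h₁₂ := hasCovDerivAt_frameTensor hσ hdom' (hx y) (x₀ := x) hk
      (f := fun x => fderiv ℝ f (x, y) (0, 1) + f (x, y) * connectionForm k σ (x, y) (0, 1))
      (v := fun x => v₂ (x, y)) hg₁
      ((hcx x y).eventually (hnear.mono fun q hq => hq.2))
    have h₂₁ := hasCovDerivAt_frameTensor hσ hdom' (hy x) (x₀ := y) hk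
      (f := fun y => fderiv ℝ f (x, y) (1, 0) + f (x, y) * connectionForm k σ (x, y) (1, 0))
      (v := fun y => v₁ (x, y)) hg₂
      ((hcy x y).eventually (hnear.mono fun q hq => hq.1))
    rw [(hdx x y).deriv] at h₁₂
    rw [(hdy x y).deriv] at h₂₁
    refine ⟨_, _, h₁₂, h₂₁, ?_⟩
    rw [hvf.self_of_nhds, transgressForm_pderiv _ hσ, ← hd, smul_smul, ← sub_smul]
    congr 1
    linear_combination hsymm
  choose v₁₂ v₂₁ hv₁₂ hv₂₁ hR using hsecond
  exact ⟨v₁, v₂, v₁₂, v₂₁, fun x y => ⟨hv₁ (x, y), hv₂ (x, y), hv₁₂ (x, y), hv₂₁ (x, y), hR (x, y)⟩⟩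

end GerbeWithConnection

end GerbeTransgression

end
theorem lemma1p4 {E : Type*} [NormedAddCommGroup E] [NormedSpace ℝ E]
    {B : Type*} [TopologicalSpace B] [ChartedSpace E B] [IsManifold 𝓘(ℝ, E) ∞ B]
    (G : GerbeTransgression.GerbeWithConnection E B) :
    G.transgression.IsCurvature (fun γ X =>
      2 * Real.pi * Complex.I * GerbeTransgression.transgressForm G.curvature γ X) :=
  G.isCurvature_transgression
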